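/- Let $\Omega$ and $\Omega'$ be relatively compact open subsets of complex manifolds $M$ and $M'$, with smooth strictly pseudoconvex boundaries $X_0$ and $X_0'$. Let $\phi:M\to\mathbb R$ be a smooth defining function of $\Omega$ ($\Omega=\{\phi>0\}$, $\overline\Omega=\{\phi\ge 0\}$ compact, $\phi=0$ and $d\phi\ne 0$ on $X_0$) such that $\log\frac1\phi$ is strictly plurisubharmonic on $\Omega$, and let $\phi'$ be such a function for $\Omega'$. Let $$X=\{(t,x)\in\mathbb C\times M:\ |t|^2=\phi(x)\},\qquad X'=\{(t',x')\in\mathbb C\times M':\ |t'|^2=\phi'(x')\}.$$ These are compact co-oriented contact manifolds: with $r=|t|^2-\phi$ and $J$ the complex structure, the contact form of $X$ is the restriction to $TX$ of $-\frac12\,dr\circ J$, and similarly for $X'$. The group $U(1)$ acts on them by $(t,x)\mapsto(e^{i\theta}t,x)$, and $X_0,X_0'$ are identified with $\{0\}\times X_0\subset X$, $\{0\}\times X_0'\subset X'$. Let $t_X,t_{X'}$ be the restrictions of the coordinate of $\mathbb C$ to $X$, $X'$. The sphere $\mathbb S^{2N+1}=\{(t,z)\in\mathbb C\times\mathbb C^N:\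 |t|^2+|z|^2=1\}$ carries the contact form $\operatorname{Im}(\bar t\,dt+\bar z\cdot dz)$ and the action $(t,z)\mapsto(e^{i\theta}t,z)$ of $U(1)$; $t_{\mathbb S}$ is its first coordinate. A smooth map is called contact if it pulls back the contact form of the target to a positive multiple of the contact form of the source. Let $f$ be a collar isomorphism, i.e. a $U(1)$-equivariant contact diffeomorphism from a $U(1)$-invariant open neighborhood of $X_0$ in $X$ onto an open neighborhood of $X_0'$ in $X'$, such that $f(X_0)=X_0'$ and such that at every point $t_{X'}\circ f$ is a positive multiple of $t_X$. **Theorem.** There is $N_0$ such that for every $N\ge N_0$ there exist $U(1)$-equivariant contact embeddings $U:X\to\mathbb S^{2N+1}$ and $U':X'\to\mathbb S^{2N+1}$ such that $U=U'\circ f$ in a neighborhood of $X_0$ in $X$, and $t_{\mathbb S}\circ U=h\,t_X$, $t_{\mathbb S}\circ U'=h'\,t_{X'}$ for smooth positive functions $h$ on $X$ and $h'$ on $X'$. -/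

import Mathlib

open Set Topology Manifold
open scoped ContDiff ComplexConjugate

noncomputable section

namespace CircleBall

/-! Throughout, `M` is a complex manifold modelled on a finite dimensional complex vector space `E`.
The same charts make it a real smooth manifold with model `𝓘(ℝ, E)`. The tangent space at a point
is identified with `E` through the preferred (holomorphic) chart there, so the complex structure on
tangent vectors is multiplication by `Complex.I` on `E`.

A complex domain `Ω = {φ > 0}` in `M` is given by its defining function `φ : M → ℝ`. -/

section

variable {E : Type*} [NormedAddCommGroup E] [NormedSpace ℂ E]
  {M : Type*} [TopologicalSpace M] [ChartedSpace E M]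
  {E' : Type*} [NormedAddCommGroup E'] [NormedSpace ℂ E']
  {M' : Type*} [TopologicalSpace M'] [ChartedSpace E' M']

/-- The differential at `x` of a real function on `M`, evaluated on a tangent vector. -/
def diff (u : M → ℝ) (x : M) (v : E) : ℝ :=
  mfderiv 𝓘(ℝ, E) 𝓘(ℝ, ℝ) u x v

/-- The Levi form (complex Hessian) `∑ (∂²u / ∂z_j ∂z̄_k) v_j v̄_k` of a real function, in the
holomorphic chart at `x`; it is a quarter of `D²u(v, v) + D²u(iv, iv)`. -/
def leviForm (u : M → ℝ) (x : M) (v : E) : ℝ :=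
  (iteratedFDeriv ℝ 2 (u ∘ (chartAt E x).symm) (chartAt E x x) ![v, v]
    + iteratedFDeriv ℝ 2 (u ∘ (chartAt E x).symm) (chartAt E x x)
        ![Complex.I • v, Complex.I • v]) / 4

/-- `Ω = {φ > 0}` is a relatively compact domain of `M` with smooth strictly pseudoconvex
boundary `{φ = 0}`, `φ` is a smooth defining function of it, and `log (1 / φ)` is strictly
plurisubharmonic on `Ω`. By regularity `{0 ≤ φ}` is the closure of `Ω`. -/
structure IsPseudoconvexDefining (φ : M → ℝ) : Prop where
  smooth : ContMDiff 𝓘(ℝ, E) 𝓘(ℝ, ℝ) ∞ φ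
  isCompact_nonneg : IsCompact {x | 0 ≤ φ x}
  regular : ∀ x, φ x = 0 → ∃ v : E, diff φ x v ≠ 0
  boundary_pseudoconvex : ∀ x, φ x = 0 → ∀ v : E, v ≠ 0 →
    diff φ x v = 0 → diff φ x (Complex.I • v) = 0 → 0 < leviForm (fun y => -φ y) x v
  log_plurisubharmonic : ∀ x, 0 < φ x → ∀ v : E, v ≠ 0 →
    0 < leviForm (fun y => Real.log (1 / φ y)) x v

/-- The boundary `X = {(t, x) : |t|² = φ x}` of the ball `{|t|² < φ}` in `ℂ × M`. -/
def ballBoundary (φ : M → ℝ) : Set (ℂ × M) := {p | ‖p.1‖ ^ 2 = φ p.2}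

/-- The boundary `X₀ = {φ = 0}` of `Ω`, seen as the subset `{0} × X₀` of `X`. -/
def binding (φ : M → ℝ) : Set (ℂ × M) := {p | p.1 = 0 ∧ φ p.2 = 0}

/-- The action `(t, x) ↦ (e^{iθ} t, x)` of `U(1)`. -/
def rot (c : Circle) (p : ℂ × M) : ℂ × M := ((c : ℂ) * p.1, p.2)

/-- The tangent vectors to `X` at `p`: the kernel of the differential of `|t|² - φ`. -/
def IsTangent (φ : M → ℝ) (p : ℂ × M) (v : ℂ × E) : Prop :=
  2 * (conj p.1 * v.1).re - diff φ p.2 v.2 = 0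

/-- The contact form of `X` as the boundary of a strictly pseudoconvex domain: the restriction of
`-(1/2) dr ∘ J` to the tangent vectors of `X`, where `r = |t|² - φ`. For the unit sphere this is
`Im (z̄ · dz)`, see `contactForm_sphereFn`. -/
def contactForm (φ : M → ℝ) (p : ℂ × M) (v : ℂ × E) : ℝ :=
  -(2 * (conj p.1 * (Complex.I * v.1)).re - diff φ p.2 (Complex.I • v.2)) / 2

/-- `F` is smooth on the subset `S` of `ℂ × M`. -/
def IsSmoothOn (F : ℂ × M → ℂ × M') (S : Set (ℂ × M)) : Prop :=
  ContMDiffOn (𝓘(ℝ, ℂ).prod 𝓘(ℝ, E)) (𝓘(ℝ, ℂ).prod 𝓘(ℝ, E')) ∞ F S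

/-- `L` is a derivative at `p` of the map `F` defined on `S`. When `S` is open in `X`, only the
restriction of `L` to the tangent vectors of `X` is used below, and that restriction is unique. -/
def HasDerivOn (F : ℂ × M → ℂ × M') (S : Set (ℂ × M)) (p : ℂ × M)
    (L : ℂ × E →L[ℝ] ℂ × E') : Prop :=
  HasMFDerivWithinAt (𝓘(ℝ, ℂ).prod 𝓘(ℝ, E)) (𝓘(ℝ, ℂ).prod 𝓘(ℝ, E')) F S p L

/-- On `S`, a piece of `X`, the map `F` to `X'` is contact: it pulls back the contact form of `X'`
to a positive multiple of the contact form of `X`. -/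
def IsContactOn (φ : M → ℝ) (φ' : M' → ℝ) (F : ℂ × M → ℂ × M') (S : Set (ℂ × M)) : Prop :=
  ∀ p ∈ S, ∃ L : ℂ × E →L[ℝ] ℂ × E', HasDerivOn F S p L ∧
    ∃ a : ℝ, 0 < a ∧ ∀ v : ℂ × E, IsTangent φ p v →
      contactForm φ' (F p) (L v) = a * contactForm φ p v

/-- On `S`, a piece of `X`, the map `F` is an immersion. -/
def IsImmersionOn (φ : M → ℝ) (F : ℂ × M → ℂ × M') (S : Set (ℂ × M)) : Prop :=
  ∀ p ∈ S, ∃ L : ℂ × E →L[ℝ] ℂ × E', HasDerivOn F S p L ∧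
    ∀ v : ℂ × E, IsTangent φ p v → L v = 0 → v = 0

/-- `f` is a collar isomorphism: an equivariant contact isomorphism from a `U(1)`-invariant
neighbourhood `f.source` of `X₀` in `X` onto a neighbourhood `f.target` of `X₀'` in `X'`, which
maps `X₀` onto `X₀'`, and for which `t' ∘ f` is a positive multiple of `t`. -/
structure IsCollarIso (φ : M → ℝ) (φ' : M' → ℝ) (f : PartialEquiv (ℂ × M) (ℂ × M')) : Prop where
  source_open : ∃ O : Set (ℂ × M), IsOpen O ∧ f.source = O ∩ ballBoundary φ
  target_open : ∃ O : Set (ℂ × M'), IsOpen O ∧ f.target = O ∩ ballBoundary φ'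
  binding_subset : binding φ ⊆ f.source
  image_binding : f '' binding φ = binding φ'
  rot_mem : ∀ c : Circle, ∀ p ∈ f.source, rot c p ∈ f.source
  smooth : IsSmoothOn (E := E) (E' := E') f f.source
  smooth_symm : IsSmoothOn (E := E') (E' := E) f.symm f.target
  equivariant : ∀ c : Circle, ∀ p ∈ f.source, f (rot c p) = rot c (f p)
  contact : IsContactOn (E := E) (E' := E') φ φ' f f.source
  t_pos : ∀ p ∈ f.source, ∃ r : ℝ, 0 < r ∧ (f p).1 = (r : ℂ) * p.1

end

/-- The unit sphere `𝕊^{2N+1} ⊆ ℂ × ℂ^N` is `X` for the unit ball of `ℂ^N` and this function. -/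
def sphereFn (N : ℕ) (z : EuclideanSpace ℂ (Fin N)) : ℝ := 1 - ‖z‖ ^ 2

theorem mem_ballBoundary_sphereFn {N : ℕ} (p : ℂ × EuclideanSpace ℂ (Fin N)) :
    p ∈ ballBoundary (sphereFn N) ↔ ‖p.1‖ ^ 2 + ‖p.2‖ ^ 2 = 1 := by
  simp only [ballBoundary, sphereFn, mem_ofPred_eq]
  constructor <;> intro h <;> linarith

theorem diff_sphereFn {N : ℕ} (z w : EuclideanSpace ℂ (Fin N)) :
    diff (sphereFn N) z w = -2 * (inner ℂ z w).re := by
  let _ : InnerProductSpace ℝ (EuclideanSpace ℂ (Fin N)) := InnerProductSpace.rclikeToReal ℂ _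
  have h := (hasStrictFDerivAt_norm_sq z).hasFDerivAt.const_sub 1
  unfold diff
  rw [mfderiv_eq_fderiv]
  change fderiv ℝ (fun z => 1 - ‖z‖ ^ 2) z w = _
  rw [h.fderiv]
  change -((2 : ℕ) • (inner ℝ z w : ℝ)) = _
  rw [real_inner_eq_re_inner ℂ]
  simp

/-- On the sphere the contact form is `Im (t̄ dt + z̄ · dz)`. -/
theorem contactForm_sphereFn {N : ℕ} (p v : ℂ × EuclideanSpace ℂ (Fin N)) :
    contactForm (sphereFn N) p v = (conj p.1 * v.1 + inner ℂ p.2 v.2).im := by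
  simp only [contactForm, diff_sphereFn, inner_smul_right]
  simp [Complex.mul_re, Complex.mul_im]
  ring

section

variable {E : Type*} [NormedAddCommGroup E] [NormedSpace ℂ E]
  {M : Type*} [TopologicalSpace M] [ChartedSpace E M]

/-- `U` is a `U(1)`-equivariant contact embedding of `X` in `𝕊^{2N+1}` (`X` is compact, so
embeddings are injective immersions). -/
structure IsContactEmbedding (φ : M → ℝ) {N : ℕ}
    (U : ℂ × M → ℂ × EuclideanSpace ℂ (Fin N)) : Prop where
  mapsTo : MapsTo U (ballBoundary φ) (ballBoundary (sphereFn N))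
  smooth : IsSmoothOn (E := E) (E' := EuclideanSpace ℂ (Fin N)) U (ballBoundary φ)
  injective : InjOn U (ballBoundary φ)
  immersion : IsImmersionOn (E := E) (E' := EuclideanSpace ℂ (Fin N)) φ U (ballBoundary φ)
  contact : IsContactOn (E := E) (E' := EuclideanSpace ℂ (Fin N)) φ (sphereFn N) U (ballBoundary φ)
  equivariant : ∀ c : Circle, ∀ p ∈ ballBoundary φ, U (rot c p) = rot c (U p)

/-- On `X`, the coordinate `t` of the sphere, pulled back by `U`, is the coordinate `t` of `X` times
a smooth positive function. -/
def PullsBackCoordinate (φ : M → ℝ) {N : ℕ}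
    (U : ℂ × M → ℂ × EuclideanSpace ℂ (Fin N)) : Prop :=
  ∃ h : ℂ × M → ℝ,
    ContMDiffOn (𝓘(ℝ, ℂ).prod 𝓘(ℝ, E)) 𝓘(ℝ, ℝ) ∞ h (ballBoundary φ) ∧
    ∀ p ∈ ballBoundary φ, 0 < h p ∧ (U p).1 = (h p : ℂ) * p.1

end

end CircleBall

end

/-! Multiplying $(t,v)$ by a positive function $s$ multiplies $\operatorname{Im}(\bar t\,dt+\bar
v\cdot dv)$ by $s^2$, because the terms with $ds$ are real (`im_conj_smul_mul`). So normalizing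
$(t,v)$ to length one gives an equivariant contact map from $X$ to the sphere, with $t_{\mathbb
S}\circ U=h\,t$, once the components of $v$ are $U(1)$-invariant and $\sum\operatorname{Im}(\bar
v_k\,dv_k)=\frac12\,d\phi\circ J$ on $TX$.

Such $v$ exist because $A\,dB-B\,dA=\operatorname{Im}(\bar w\,dw)$ for $w=A+iB$, and every smooth
real one-form on a compact set is a finite sum of such expressions; `isRepresentable_diff_I` does
this for $\frac12\,d\phi\circ J$. Real components contribute nothing to $\operatorname{Im}(\bar
v\,dv)$, so enough of them can be added to embed the base. A constant component among them prevents
normalization from identifying distinct points or killing tangent vectors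
(`IsEmbeddingTuple.of_parts`, `IsEmbeddingTuple.isContactEmbedding`).

For the collar, the contact condition on the generator of the rotations shows that $t'\circ f=r\,t$
with $r^2$ the conformal factor, and then $f$ pulls $d\phi'\circ J$ back to $r^2\,d\phi\circ J$
(`IsCollarIso.exists_factor`). Hence if $u'$ solves the problem on $M'$, then $r^{-1}u'\circ f$
solves it on the collar of $X$. Since $\operatorname{Im}(\bar v\,dv)$ is quadratic under real
scaling, two solutions are glued by weights $\chi,\psi$ with $\chi^2+\psi^2=1$, here a cosine and a
sine. Each side also carries a cut-off, rescaled copy of the real components of the other. Near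
$X_0$ the tuple of $X'$ at $f(p)$ is then $r(p)$ times the tuple of $X$ at $p$, and both normalize
to the same point (`sphereMap_eq_of_smul`). -/

noncomputable section

namespace CircleBall

/-! ### Holomorphic charts seen as real charts -/

section Model

variable {E : Type*} [NormedAddCommGroup E] [NormedSpace ℂ E]
  {M : Type*} [TopologicalSpace M] [ChartedSpace E M]

/-- A complex manifold is a real smooth manifold. -/
theorem isManifold_real [IsManifold 𝓘(ℂ, E) ω M] : IsManifold 𝓘(ℝ, E) ∞ M := by
  refine isManifold_of_contDiffOn 𝓘(ℝ, E) ∞ M fun e e' he he' => ?_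
  have h := (contDiffGroupoid ω 𝓘(ℂ, E)).compatible he he'
  have h1 : ContDiffOn ℂ ω (𝓘(ℂ, E) ∘ e.symm ≫ₕ e' ∘ 𝓘(ℂ, E).symm)
      (𝓘(ℂ, E).symm ⁻¹' (e.symm ≫ₕ e').source ∩ range 𝓘(ℂ, E)) := h.1
  exact (h1.restrict_scalars ℝ).of_le le_top

/-- The differential of a holomorphic chart is complex linear and injective. -/
theorem exists_hasMFDerivAt_chartAt [IsManifold 𝓘(ℂ, E) ω M] (x₀ : M) {x : M}
    (hx : x ∈ (chartAt E x₀).source) :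
    ∃ T : E →L[ℂ] E, HasMFDerivAt 𝓘(ℝ, E) 𝓘(ℝ, E) (chartAt E x₀) x (T.restrictScalars ℝ) ∧
      Function.Injective T := by
  have : IsManifold 𝓘(ℂ, E) 1 M := IsManifold.of_le (n := ω) le_top
  have h := (mdifferentiableAt_atlas (I := 𝓘(ℂ, E)) (chart_mem_atlas E x₀) hx).hasMFDerivAt
  refine ⟨mfderiv 𝓘(ℂ, E) 𝓘(ℂ, E) (chartAt E x₀) x, ⟨h.1, ?_⟩,
    (mdifferentiable_chart (I := 𝓘(ℂ, E)) x₀).mfderiv_injective hx⟩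
  have h2 : HasFDerivWithinAt (𝕜 := ℂ) (E := E) (F := E)
      (writtenInExtChartAt 𝓘(ℂ, E) 𝓘(ℂ, E) x (chartAt E x₀))
      (mfderiv 𝓘(ℂ, E) 𝓘(ℂ, E) (chartAt E x₀) x) (range 𝓘(ℂ, E)) (extChartAt 𝓘(ℂ, E) x x) := h.2
  exact h2.restrictScalars ℝ

end Model

/-! ### Parametrizing regular level sets -/

/-- A regular level set has a smooth local parametrization by the coordinate space, which is a
retraction in the coordinates. -/
theorem exists_local_parametrization {F : Type*} [NormedAddCommGroup F] [NormedSpace ℝ F]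
    [CompleteSpace F] {H : Type*} [TopologicalSpace H] (I : ModelWithCorners ℝ F H)
    [I.Boundaryless] {N : Type*} [TopologicalSpace N] [ChartedSpace H N] [IsManifold I ∞ N]
    {ρ : N → ℝ} (hρ : ContMDiff I 𝓘(ℝ, ℝ) ∞ ρ) (p : N) (hp : ρ p = 0) {ℓ : F →L[ℝ] ℝ}
    (hℓ : HasMFDerivAt I 𝓘(ℝ, ℝ) ρ p ℓ) (hℓ0 : ℓ ≠ 0) :
    ∃ κ : F → N,
      ContMDiffAt 𝓘(ℝ, F) I ∞ κ (extChartAt I p p) ∧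
      (∀ᶠ y in 𝓝 (extChartAt I p p), MDifferentiableAt 𝓘(ℝ, F) I κ y) ∧
      (∀ᶠ y in 𝓝 (extChartAt I p p), ρ (κ y) = 0) ∧
      (∀ᶠ q in 𝓝 p, ρ q = 0 → κ (extChartAt I p q) = q) ∧
      κ (extChartAt I p p) = p ∧
      ∃ K : F →L[ℝ] F, HasMFDerivAt 𝓘(ℝ, F) I κ (extChartAt I p p) K ∧
        ∀ v, ℓ v = 0 → K v = v := by
  obtain ⟨y₀, hy₀⟩ : ∃ y₀, y₀ = extChartAt I p p := ⟨_, rfl⟩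
  rw [← hy₀]
  set ρ' : F → ℝ := fun y => ρ ((extChartAt I p).symm y) with hρ'
  have hsymm : ContMDiffAt 𝓘(ℝ, F) I ∞ (extChartAt I p).symm y₀ :=
    hy₀ ▸ (contMDiffOn_extChartAt_symm p).contMDiffAt (extChartAt_target_mem_nhds p)
  have htarget : (extChartAt I p).target ∈ 𝓝 y₀ := hy₀ ▸ extChartAt_target_mem_nhds p
  have hsymm' : ∀ᶠ y in 𝓝 y₀, ContMDiffAt 𝓘(ℝ, F) I ∞ (extChartAt I p).symm y := by
    filter_upwards [eventually_mem_nhds_iff.2 htarget] with y hy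
    exact (contMDiffOn_extChartAt_symm p).contMDiffAt hy
  have hsmooth : ContDiffAt ℝ ∞ ρ' y₀ :=
    contMDiffAt_iff_contDiffAt.1 (hρ.contMDiffAt.comp y₀ hsymm)
  have hd : HasFDerivAt ρ' ℓ y₀ := by
    have h : HasFDerivWithinAt (𝕜 := ℝ) (E := F) (F := ℝ) ρ' ℓ (range I) (extChartAt I p p) := hℓ.2
    rwa [I.range_eq_univ, hasFDerivWithinAt_univ, ← hy₀] at h
  obtain ⟨e, hle⟩ : ∃ e, ℓ e = 1 := by
    obtain ⟨v, hv⟩ := DFunLike.ne_iff.1 hℓ0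
    exact ⟨(ℓ v)⁻¹ • v, by simpa using inv_mul_cancel₀ hv⟩
  have hsymm_y₀ : (extChartAt I p).symm y₀ = p := hy₀ ▸ extChartAt_to_inv p
  have hρy₀ : ρ' y₀ = 0 := by simp only [hρ', hsymm_y₀, hp]
  have hℓd : HasFDerivAt (fun y => ℓ (y - y₀)) ℓ y₀ :=
    ℓ.hasFDerivAt.comp y₀ ((hasFDerivAt_id y₀).sub_const y₀)
  -- `Θ` straightens the level set: it has identity derivative at `y₀` and turns `ρ'` into the
  -- affine function `ℓ (· - y₀)`.
  set Θ : F → F := fun y => y + (ρ' y - ℓ (y - y₀)) • e with hΘ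
  have hΘ₀ : Θ y₀ = y₀ := by simp [hΘ, hρy₀]
  have hℓΘ : ∀ y, ℓ (Θ y - y₀) = ρ' y := fun y => by
    simp only [hΘ, map_sub, map_add, map_smul, hle, smul_eq_mul]; ring
  have hΘs : ContDiffAt ℝ ∞ Θ y₀ := by
    have : ContDiffAt ℝ ∞ (fun y => ℓ (y - y₀)) y₀ := by fun_prop
    exact contDiffAt_id.add ((hsmooth.sub this).smul contDiffAt_const)
  have hΘd : HasFDerivAt Θ ((ContinuousLinearEquiv.refl ℝ F : F ≃L[ℝ] F) : F →L[ℝ] F) y₀ := by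
    refine ((hasFDerivAt_id y₀).add ((hd.sub hℓd).smul_const e)).congr_fderiv ?_
    ext v; simp
  have hΘss := hΘs.hasStrictFDerivAt' hΘd (by simp)
  obtain ⟨Ξ, hΞ⟩ : ∃ Ξ, Ξ = hΘs.localInverse hΘd (by simp) := ⟨_, rfl⟩
  have hΞs : ContDiffAt ℝ ∞ Ξ y₀ := by
    have := hΘs.to_localInverse hΘd (by simp)
    rwa [hΘ₀, ← hΞ] at this
  have hleft : ∀ᶠ y in 𝓝 y₀, Ξ (Θ y) = y := hΞ ▸ hΘss.eventually_left_inverse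
  have hright : ∀ᶠ y in 𝓝 y₀, Θ (Ξ y) = y := by
    have : ∀ᶠ y in 𝓝 (Θ y₀), Θ (Ξ y) = y := hΞ ▸ hΘss.eventually_right_inverse
    rwa [hΘ₀] at this
  have hΞd : HasFDerivAt Ξ (ContinuousLinearMap.id ℝ F) y₀ := by
    have := hΘss.to_localInverse.hasFDerivAt
    rw [hΘ₀] at this
    exact hΞ ▸ this
  have hΞ₀ : Ξ y₀ = y₀ := by
    have := hleft.self_of_nhds
    rwa [hΘ₀] at this
  -- `A` projects along `e` onto the hyperplane `ℓ (y - y₀) = 0` and equals `Θ` where `ρ'` vanishes.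
  -- So `Ξ ∘ A` lands in the level set and fixes its points, and its source is all of `F` rather
  -- than the hyperplane.
  set A : F → F := fun y => y - ℓ (y - y₀) • e with hA
  have hA₀ : A y₀ = y₀ := by simp [hA]
  have hAs : ContDiff ℝ ∞ A := by fun_prop
  have hAc : Filter.Tendsto A (𝓝 y₀) (𝓝 y₀) := by
    have := hAs.continuous.tendsto y₀
    rwa [hA₀] at this
  have hAd : HasFDerivAt A (ContinuousLinearMap.id ℝ F - ℓ.smulRight e) y₀ :=
    (hasFDerivAt_id y₀).sub (hℓd.smul_const e)
  have hΞc : Filter.Tendsto Ξ (𝓝 y₀) (𝓝 y₀) := by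
    have := hΞs.continuousAt.tendsto
    rwa [hΞ₀] at this
  have hΞs' : ∀ᶠ y in 𝓝 y₀, DifferentiableAt ℝ Ξ y := by
    filter_upwards [(hΞs.of_le (m := 1) (by simp)).eventually (by simp)] with y hy
    exact hy.differentiableAt (by simp)
  refine ⟨fun y => (extChartAt I p).symm (Ξ (A y)), ?_, ?_, ?_, ?_, ?_,
    ContinuousLinearMap.id ℝ F - ℓ.smulRight e, ?_, ?_⟩
  · have h1 : ContDiffAt ℝ ∞ (Ξ ∘ A) y₀ :=
      ContDiffAt.comp y₀ (by rwa [hA₀]) hAs.contDiffAt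
    exact ContMDiffAt.comp y₀ (g := (extChartAt I p).symm) (f := Ξ ∘ A)
      (by simpa only [Function.comp_apply, hA₀, hΞ₀] using hsymm) h1.contMDiffAt
  · filter_upwards [hAc.eventually hΞs', (hΞc.comp hAc).eventually hsymm'] with y h1 h2
    exact (h2.mdifferentiableAt (by simp)).comp y
      ((h1.comp y (hAs.differentiable (by simp) y)).mdifferentiableAt)
  · filter_upwards [hAc.eventually hright] with y hy
    change ρ' (Ξ (A y)) = 0
    rw [← hℓΘ, hy]
    simp [hA, hle]
  · have hc : Filter.Tendsto (extChartAt I p) (𝓝 p) (𝓝 y₀) := hy₀ ▸ continuousAt_extChartAt p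
    filter_upwards [hc.eventually hleft, extChartAt_source_mem_nhds (I := I) p] with q hq hqs h0
    have h1 : (extChartAt I p).symm (extChartAt I p q) = q := (extChartAt I p).left_inv hqs
    have h2 : A (extChartAt I p q) = Θ (extChartAt I p q) := by
      simp only [hA, hΘ, hρ', h1, h0, sub_eq_add_neg, zero_add, neg_smul]
    rw [h2, hq, h1]
  · simp only [hA₀, hΞ₀, hsymm_y₀]
  · have hp' : (extChartAt I p).symm (Ξ (A y₀)) = p := by simp only [hA₀, hΞ₀, hsymm_y₀]
    have hκ : ContinuousAt (fun y => (extChartAt I p).symm (Ξ (A y))) y₀ := by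
      refine ContinuousAt.comp (g := (extChartAt I p).symm) ?_ ((ContinuousAt.comp (g := Ξ) ?_
        hAs.continuous.continuousAt))
      · rw [hA₀, hΞ₀]; exact hsymm.continuousAt
      · rw [hA₀]; exact hΞs.continuousAt
    have h3 : HasFDerivAt (Ξ ∘ A) (ContinuousLinearMap.id ℝ F - ℓ.smulRight e) y₀ :=
      HasFDerivAt.comp y₀ (g := Ξ) (g' := ContinuousLinearMap.id ℝ F) (by rwa [hA₀]) hAd
    refine ⟨hκ, ?_⟩
    have h4 : HasFDerivAt (fun y => extChartAt I ((extChartAt I p).symm (Ξ (A y₀)))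
        ((extChartAt I p).symm (Ξ (A y)))) (ContinuousLinearMap.id ℝ F - ℓ.smulRight e) y₀ := by
      rw [hp']
      refine h3.congr_of_eventuallyEq ?_
      filter_upwards [(hΞc.comp hAc).eventually htarget] with y hy
      exact (extChartAt I p).right_inv hy
    exact h4.hasFDerivWithinAt
  · intro v hv
    simp [hv]

/-- The product rule for $sz$ gives $s\,dz+z\,ds$, and $\bar z z\,ds$ is real. This is why rescaling
is conformal and why cut-offs act through their squares. -/
theorem im_conj_smul_mul (s l : ℝ) (a b : ℂ) :
    (conj (s • a) * (s • b + l • a)).im = s ^ 2 * (conj a * b).im := by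
  simp
  ring

/-! ### Derivatives of vector-valued functions on a manifold -/

section Calculus

variable {F : Type*} [NormedAddCommGroup F] [NormedSpace ℝ F] {H : Type*} [TopologicalSpace H]
  {I : ModelWithCorners ℝ F H} {N : Type*} [TopologicalSpace N] [ChartedSpace H N]
  {V : Type*} [NormedAddCommGroup V] [NormedSpace ℝ V]
  {W : Type*} [NormedAddCommGroup W] [NormedSpace ℝ W] {S : Set N} {p : N}

/-- The chart of a vector space is the identity, so the rules of the Fréchet derivative carry over.
-/
theorem hasMFDerivWithinAt_vector_iff {u : N → V} {L : F →L[ℝ] V} :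
    HasMFDerivWithinAt I 𝓘(ℝ, V) u S p L ↔ ContinuousWithinAt u S p ∧
      HasFDerivWithinAt (fun y => u ((extChartAt I p).symm y)) L
        ((extChartAt I p).symm ⁻¹' S ∩ range I) (extChartAt I p p) := Iff.rfl

theorem HasMFDerivWithinAt.vector_smul {A : N → ℝ} {u : N → V} {LA : F →L[ℝ] ℝ} {L : F →L[ℝ] V}
    (hA : HasMFDerivWithinAt I 𝓘(ℝ, ℝ) A S p LA) (hu : HasMFDerivWithinAt I 𝓘(ℝ, V) u S p L) :
    HasMFDerivWithinAt I 𝓘(ℝ, V) (fun q => A q • u q) S p (A p • L + LA.smulRight (u p)) := by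
  rw [hasMFDerivWithinAt_vector_iff] at *
  have h := hA.2.smul hu.2
  rw [extChartAt_to_inv] at h
  exact ⟨hA.1.smul hu.1, h⟩

theorem HasMFDerivWithinAt.vector_clm_comp (T : V →L[ℝ] W) {u : N → V} {L : F →L[ℝ] V}
    (hu : HasMFDerivWithinAt I 𝓘(ℝ, V) u S p L) :
    HasMFDerivWithinAt I 𝓘(ℝ, W) (fun q => T (u q)) S p (T.comp L) := by
  rw [hasMFDerivWithinAt_vector_iff] at *
  exact ⟨T.continuous.continuousAt.comp_continuousWithinAt hu.1,
    T.hasFDerivAt.comp_hasFDerivWithinAt _ hu.2⟩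

theorem HasMFDerivWithinAt.vector_add {u u' : N → V} {L L' : F →L[ℝ] V}
    (hu : HasMFDerivWithinAt I 𝓘(ℝ, V) u S p L) (hu' : HasMFDerivWithinAt I 𝓘(ℝ, V) u' S p L') :
    HasMFDerivWithinAt I 𝓘(ℝ, V) (fun q => u q + u' q) S p (L + L') := by
  rw [hasMFDerivWithinAt_vector_iff] at *
  exact ⟨hu.1.add hu'.1, hu.2.add hu'.2⟩

end Calculus

/-! ### One-forms of the shape $\sum\operatorname{Im}(\bar w_i\,dw_i)$ -/

section Forms

variable {E : Type*} [NormedAddCommGroup E] [NormedSpace ℂ E]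
  {M : Type*} [TopologicalSpace M] [ChartedSpace E M]

/-- The differential at `x` of a complex function on `M`, evaluated on a tangent vector. -/
def cdiff (w : M → ℂ) (x : M) (v : E) : ℂ :=
  mfderiv 𝓘(ℝ, E) 𝓘(ℝ, ℂ) w x v

theorem diff_eq {u : M → ℝ} {x : M} {L : E →L[ℝ] ℝ}
    (h : HasMFDerivWithinAt 𝓘(ℝ, E) 𝓘(ℝ, ℝ) u univ x L) (v : E) : diff u x v = L v := by
  rw [diff, (hasMFDerivWithinAt_univ.1 h).mfderiv]
  rfl

theorem cdiff_eq {u : M → ℂ} {x : M} {L : E →L[ℝ] ℂ}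
    (h : HasMFDerivWithinAt 𝓘(ℝ, E) 𝓘(ℝ, ℂ) u univ x L) (v : E) : cdiff u x v = L v := by
  rw [cdiff, (hasMFDerivWithinAt_univ.1 h).mfderiv]
  rfl

theorem exists_hasMFDerivAt_diff {u : M → ℝ} {x : M}
    (h : MDifferentiableAt 𝓘(ℝ, E) 𝓘(ℝ, ℝ) u x) :
    ∃ L : E →L[ℝ] ℝ, HasMFDerivWithinAt 𝓘(ℝ, E) 𝓘(ℝ, ℝ) u univ x L ∧ ∀ v, diff u x v = L v :=
  ⟨mfderiv 𝓘(ℝ, E) 𝓘(ℝ, ℝ) u x, hasMFDerivWithinAt_univ.2 h.hasMFDerivAt, fun _ => rfl⟩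

theorem exists_hasMFDerivAt_cdiff {u : M → ℂ} {x : M}
    (h : MDifferentiableAt 𝓘(ℝ, E) 𝓘(ℝ, ℂ) u x) :
    ∃ L : E →L[ℝ] ℂ, HasMFDerivWithinAt 𝓘(ℝ, E) 𝓘(ℝ, ℂ) u univ x L ∧ ∀ v, cdiff u x v = L v :=
  ⟨mfderiv 𝓘(ℝ, E) 𝓘(ℝ, ℂ) u x, hasMFDerivWithinAt_univ.2 h.hasMFDerivAt, fun _ => rfl⟩

theorem diff_mul {A u : M → ℝ} {x : M} (hA : MDifferentiableAt 𝓘(ℝ, E) 𝓘(ℝ, ℝ) A x)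
    (hu : MDifferentiableAt 𝓘(ℝ, E) 𝓘(ℝ, ℝ) u x) (v : E) :
    diff (fun y => A y * u y) x v = A x * diff u x v + diff A x v * u x := by
  obtain ⟨LA, hLA, hA'⟩ := exists_hasMFDerivAt_diff hA
  obtain ⟨L, hL, hu'⟩ := exists_hasMFDerivAt_diff hu
  refine (diff_eq (HasMFDerivWithinAt.vector_smul hLA hL) v).trans ?_
  rw [hA', hu']
  simp

/-- The real form `α` on `K` is `∑ Im (w̄ᵢ dwᵢ)` for finitely many complex functions `wᵢ` that are
smooth at the points of `K`. -/
def IsRepresentable (K : Set M) (α : M → E → ℝ) : Prop :=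
  ∃ (ι : Type) (_ : Fintype ι) (w : ι → M → ℂ),
    (∀ i, ∀ x ∈ K, ContMDiffAt 𝓘(ℝ, E) 𝓘(ℝ, ℂ) ∞ (w i) x) ∧
    ∀ x ∈ K, ∀ v, ∑ i, (conj (w i x) * cdiff (w i) x v).im = α x v

namespace IsRepresentable

variable {K : Set M} {α α' : M → E → ℝ}

theorem congr (h : IsRepresentable K α) (h' : ∀ x ∈ K, ∀ v, α x v = α' x v) :
    IsRepresentable K α' := by
  obtain ⟨ι, _, w, hw, hα⟩ := h
  exact ⟨ι, _, w, hw, fun x hx v => (hα x hx v).trans (h' x hx v)⟩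

theorem zero : IsRepresentable K fun (_ : M) (_ : E) => 0 :=
  ⟨Empty, inferInstance, fun i => i.elim, fun i => i.elim, by simp⟩

theorem add (h : IsRepresentable K α) (h' : IsRepresentable K α') :
    IsRepresentable K fun x v => α x v + α' x v := by
  obtain ⟨ι, _, w, hw, hα⟩ := h
  obtain ⟨ι', _, w', hw', hα'⟩ := h'
  refine ⟨ι ⊕ ι', inferInstance, Sum.elim w w', ?_, fun x hx v => ?_⟩
  · rintro (i | i)
    exacts [hw i, hw' i]
  · simp [← hα x hx v, ← hα' x hx v]

theorem sum {ι : Type*} (s : Finset ι) {α : ι → M → E → ℝ} (h : ∀ i, IsRepresentable K (α i)) :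
    IsRepresentable K fun x v => ∑ i ∈ s, α i x v := by
  classical
  induction s using Finset.induction_on with
  | empty => simpa using zero
  | insert i s hi ih => simpa [Finset.sum_insert hi] using (h i).add ih

/-- Replacing each $w_i$ by $s\,w_i$ suffices, since the $ds$ terms are real. Applied with a square
root, it multiplies by positive smooth functions. -/
theorem sq_mul (h : IsRepresentable K α) {s : M → ℝ}
    (hs : ∀ x ∈ K, ContMDiffAt 𝓘(ℝ, E) 𝓘(ℝ, ℝ) ∞ s x) :
    IsRepresentable K fun x v => s x ^ 2 * α x v := by
  obtain ⟨ι, _, w, hw, hα⟩ := h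
  refine ⟨ι, ‹_›, fun i x => s x • w i x, fun i x hx => (hs x hx).smul (hw i x hx),
    fun x hx v => ?_⟩
  change _ = s x ^ 2 * α x v
  rw [← hα x hx v, Finset.mul_sum]
  refine Finset.sum_congr rfl fun i _ => ?_
  obtain ⟨Ls, hLs, -⟩ := exists_hasMFDerivAt_diff ((hs x hx).mdifferentiableAt (by simp))
  obtain ⟨L, hL, hw'⟩ := exists_hasMFDerivAt_cdiff ((hw i x hx).mdifferentiableAt (by simp))
  rw [cdiff_eq (HasMFDerivWithinAt.vector_smul hLs hL), hw']
  simp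
  ring

/-- `A dB - B dA = Im (w̄ dw)` for `w = A + i B`. -/
theorem wedge {A B : M → ℝ} (hA : ∀ x ∈ K, ContMDiffAt 𝓘(ℝ, E) 𝓘(ℝ, ℝ) ∞ A x)
    (hB : ∀ x ∈ K, ContMDiffAt 𝓘(ℝ, E) 𝓘(ℝ, ℝ) ∞ B x) :
    IsRepresentable K fun (x : M) (v : E) => A x * diff B x v - B x * diff A x v := by
  refine ⟨Unit, inferInstance, fun _ x => Complex.ofRealCLM (A x) +
    (Complex.I • Complex.ofRealCLM) (B x), fun _ x hx => ?_, fun x hx v => ?_⟩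
  · exact ((Complex.ofRealCLM.contDiff.contMDiff.contMDiffAt).comp x (hA x hx)).add
      (((Complex.I • Complex.ofRealCLM).contDiff.contMDiff.contMDiffAt).comp x (hB x hx))
  · obtain ⟨LA, hLA, hA'⟩ := exists_hasMFDerivAt_diff ((hA x hx).mdifferentiableAt (by simp))
    obtain ⟨LB, hLB, hB'⟩ := exists_hasMFDerivAt_diff ((hB x hx).mdifferentiableAt (by simp))
    simp only [Finset.univ_unique, Finset.sum_singleton]
    have h : cdiff (fun x => Complex.ofRealCLM (A x) + (Complex.I • Complex.ofRealCLM) (B x)) x v =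
        (LA v : ℂ) + Complex.I * (LB v : ℂ) :=
      cdiff_eq (HasMFDerivWithinAt.vector_add
        (HasMFDerivWithinAt.vector_clm_comp Complex.ofRealCLM hLA)
        (HasMFDerivWithinAt.vector_clm_comp (Complex.I • Complex.ofRealCLM) hLB)) v
    rw [h, hA', hB']
    simp
    ring

/-- `2 b² c dy = (bc) d(by) - (by) d(bc) + b d(bcy) - bcy db`. -/
theorem mul_diff {b c y : M → ℝ} (hb : ContMDiff 𝓘(ℝ, E) 𝓘(ℝ, ℝ) ∞ b)
    (hbc : ContMDiff 𝓘(ℝ, E) 𝓘(ℝ, ℝ) ∞ fun x => b x * c x)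
    (hby : ContMDiff 𝓘(ℝ, E) 𝓘(ℝ, ℝ) ∞ fun x => b x * y x)
    (hbcy : ContMDiff 𝓘(ℝ, E) 𝓘(ℝ, ℝ) ∞ fun x => b x * (c x * y x))
    (hc : ∀ x, b x ≠ 0 → MDifferentiableAt 𝓘(ℝ, E) 𝓘(ℝ, ℝ) c x)
    (hy : ∀ x, b x ≠ 0 → MDifferentiableAt 𝓘(ℝ, E) 𝓘(ℝ, ℝ) y x) :
    IsRepresentable K fun (x : M) (v : E) => b x ^ 2 * (c x * diff y x v) := by
  -- Only products with the cut-off `b` are globally smooth, so `c` and `y` enter through `b`, `bc`,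
  -- `by` and `bcy`. The two wedges add up to twice the target, which the factor $1/\sqrt2$
  -- corrects. Where `b` vanishes, so do all the coefficients.
  have h := ((wedge (K := K) (fun x _ => hbc x) (fun x _ => hby x)).add
    (wedge (K := K) (fun x _ => hb x) (fun x _ => hbcy x))).sq_mul (s := fun _ => (√2)⁻¹)
    (fun x _ => contMDiffAt_const)
  refine h.congr fun x _ v => ?_
  have h2 : ((√2)⁻¹ : ℝ) ^ 2 = 1 / 2 := by rw [inv_pow, Real.sq_sqrt (by norm_num)]; norm_num
  simp only [h2]
  by_cases hx : b x = 0
  · simp [hx]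
  · have hb' := (hb x).mdifferentiableAt (n := ∞) (by simp)
    have h3 : MDifferentiableAt 𝓘(ℝ, E) 𝓘(ℝ, ℝ) (fun x => c x * y x) x := (hc x hx).mul (hy x hx)
    rw [diff_mul hb' (hc x hx), diff_mul hb' (hy x hx), diff_mul hb' h3,
      diff_mul (hc x hx) (hy x hx)]
    ring

end IsRepresentable

end Forms

/-! ### Embeddings and primitives over a compact set of the base -/

section Compact

variable {E : Type*} [NormedAddCommGroup E] [NormedSpace ℂ E] [FiniteDimensional ℂ E]
  {M : Type*} [TopologicalSpace M] [ChartedSpace E M]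

/-- Finitely many bump functions whose plateaus cover a compact set. -/
theorem exists_bump_cover {K : Set M} (hK : IsCompact K) :
    ∃ (n : ℕ) (c : Fin n → M) (b : ∀ i, SmoothBumpFunction 𝓘(ℝ, E) (c i)),
      ∀ x ∈ K, ∃ i, ∀ᶠ y in 𝓝 x, b i y = 1 := by
  have : FiniteDimensional ℝ E := FiniteDimensional.complexToReal E
  have hb : ∀ x : M, ∃ b : SmoothBumpFunction 𝓘(ℝ, E) x, True :=
    fun x => ⟨Classical.choice inferInstance, trivial⟩
  choose b _ using hb
  obtain ⟨t, -, ht⟩ := hK.elim_nhds_subcover (fun x => interior {y | b x y = 1})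
    fun x _ => interior_mem_nhds.2 (b x).eventuallyEq_one
  refine ⟨t.card, fun i => (t.equivFin.symm i : M), fun i => b _, fun x hx => ?_⟩
  obtain ⟨c, hc, hxc⟩ := mem_iUnion₂.1 (ht hx)
  obtain ⟨j, hj⟩ := t.equivFin.symm.surjective ⟨c, hc⟩
  refine ⟨j, ?_⟩
  beta_reduce
  rw [hj]
  exact mem_interior_iff_mem_nhds.1 hxc

variable [T2Space M] [IsManifold 𝓘(ℂ, E) ω M]

/-- Finitely many smooth real functions, one of them constant, which embed a compact set. -/
theorem exists_real_embedding {K : Set M} (hK : IsCompact K) :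
    ∃ (κ : Type) (_ : Fintype κ) (g : κ → M → ℝ),
      (∀ k, ContMDiff 𝓘(ℝ, E) 𝓘(ℝ, ℝ) ∞ (g k)) ∧ (∃ k, ∀ x, g k x = 1) ∧
      (∀ x ∈ K, ∀ y ∈ K, (∀ k, g k x = g k y) → x = y) ∧
      ∀ x ∈ K, ∀ v : E, (∀ k, diff (g k) x v = 0) → v = 0 := by
  have : FiniteDimensional ℝ E := FiniteDimensional.complexToReal E
  have : IsManifold 𝓘(ℝ, E) ∞ M := isManifold_real
  obtain ⟨n, c, b, hb⟩ := exists_bump_cover (E := E) hK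
  set B := Module.finBasis ℝ E
  set ℓ : Fin (Module.finrank ℝ E) → E →L[ℝ] ℝ := fun k => (B.coord k).toContinuousLinearMap
    with hℓ
  have hℓ0 : ∀ v, (∀ k, ℓ k v = 0) → v = 0 := fun v hv =>
    B.ext_elem fun k => by simpa [hℓ] using hv k
  have hchart : ∀ i, ContMDiffOn 𝓘(ℝ, E) 𝓘(ℝ, E) ∞ (chartAt E (c i)) (chartAt E (c i)).source :=
    fun i => contMDiffOn_chart
  -- The family is $1$, the bumps $b_i$, and the products of $b_i$ with the real chart coordinates.
  -- A value $b_i=1$ forces a point into the chart domain, where the coordinates separate.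
  refine ⟨Option (Fin n × Option (Fin (Module.finrank ℝ E))), inferInstance,
    fun k x => k.elim 1 fun k => k.2.elim (b k.1 x) fun j => b k.1 x • ℓ j (chartAt E (c k.1) x),
    ?_, ⟨none, fun x => rfl⟩, fun x hx y hy h => ?_, fun x hx v h => ?_⟩
  · rintro (_ | ⟨i, _ | j⟩)
    · exact contMDiff_const
    · exact (b i).contMDiff
    · exact (b i).contMDiff_smul ((ℓ j).contMDiff.comp_contMDiffOn (hchart i))
  · obtain ⟨i, hi⟩ := hb x hx
    have hbx : b i x = 1 := hi.self_of_nhds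
    have hby : b i y = 1 := (h (some (i, none))).symm.trans hbx
    have hsx : x ∈ (chartAt E (c i)).source :=
      (b i).support_subset_source (by simp [Function.mem_support, hbx])
    have hsy : y ∈ (chartAt E (c i)).source :=
      (b i).support_subset_source (by simp [Function.mem_support, hby])
    refine (chartAt E (c i)).injOn hsx hsy (sub_eq_zero.1 (hℓ0 _ fun j => ?_))
    have := h (some (i, some j))
    simp only [Option.elim, hbx, hby, one_smul] at this
    rw [map_sub, this, sub_self]
  · obtain ⟨i, hi⟩ := hb x hx
    have hbx : b i x = 1 := hi.self_of_nhds
    have hsx : x ∈ (chartAt E (c i)).source :=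
      (b i).support_subset_source (by simp [Function.mem_support, hbx])
    obtain ⟨T, hT, hT'⟩ := exists_hasMFDerivAt_chartAt (c i) hsx
    refine hT' ((hℓ0 _ fun j => ?_).trans (map_zero T).symm)
    rw [← h (some (i, some j))]
    have h1 := HasMFDerivWithinAt.vector_clm_comp (ℓ j) (hasMFDerivWithinAt_univ.2 hT)
    refine (diff_eq (L := (ℓ j).comp (T.restrictScalars ℝ))
      (h1.congr_of_eventuallyEq ?_ ?_) v).symm
    · rw [nhdsWithin_univ]
      filter_upwards [hi] with y hy
      simp [hy]
    · simp [hbx]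

/-- The form `½ dφ ∘ J` is representable on compact sets. -/
theorem isRepresentable_diff_I {φ : M → ℝ} (hφ : ContMDiff 𝓘(ℝ, E) 𝓘(ℝ, ℝ) ∞ φ) {K : Set M}
    (hK : IsCompact K) :
    IsRepresentable K fun (x : M) (v : E) => diff φ x (Complex.I • v) / 2 := by
  have : FiniteDimensional ℝ E := FiniteDimensional.complexToReal E
  have : IsManifold 𝓘(ℝ, E) ∞ M := isManifold_real
  obtain ⟨n, c, b, hb⟩ := exists_bump_cover (E := E) hK
  set B := Module.finBasis ℝ E
  set ℓ : Fin (Module.finrank ℝ E) → E →L[ℝ] ℝ := fun k => (B.coord k).toContinuousLinearMap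
    with hℓ
  have hsum : ∀ v, ∑ k, ℓ k v • B k = v := fun v => by simp [hℓ, B.sum_repr]
  set Φ : Fin n → E → ℝ := fun i y => φ ((chartAt E (c i)).symm y) with hΦ
  set y : Fin n → Fin (Module.finrank ℝ E) → M → ℝ := fun i k x => ℓ k (chartAt E (c i) x) with hy
  set a : Fin n → Fin (Module.finrank ℝ E) → M → ℝ := fun i k x =>
    fderiv ℝ (Φ i) (chartAt E (c i) x) (Complex.I • B k) / 2 with ha
  have hchart : ∀ i, ContMDiffOn 𝓘(ℝ, E) 𝓘(ℝ, E) ∞ (chartAt E (c i)) (chartAt E (c i)).source :=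
    fun i => contMDiffOn_chart
  have hΦs : ∀ i, ContDiffOn ℝ ∞ (Φ i) (chartAt E (c i)).target := fun i =>
    contMDiffOn_iff_contDiffOn.1 (hφ.comp_contMDiffOn (contMDiffOn_chart_symm (x := c i)))
  have hys : ∀ i k, ContMDiffOn 𝓘(ℝ, E) 𝓘(ℝ, ℝ) ∞ (y i k) (chartAt E (c i)).source :=
    fun i k => (ℓ k).contMDiff.comp_contMDiffOn (hchart i)
  have has : ∀ i k, ContMDiffOn 𝓘(ℝ, E) 𝓘(ℝ, ℝ) ∞ (a i k) (chartAt E (c i)).source := by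
    intro i k
    have h1 : ContDiffOn ℝ ∞ (fun z => fderiv ℝ (Φ i) z (Complex.I • B k) / 2)
        (chartAt E (c i)).target :=
      (((hΦs i).fderiv_of_isOpen (chartAt E (c i)).open_target (by simp)).clm_apply
        contDiffOn_const).div_const 2
    exact h1.contMDiffOn.comp (hchart i) fun x hx => (chartAt E (c i)).map_source hx
  have hmd : ∀ {i : Fin n} {u : M → ℝ},
      ContMDiffOn 𝓘(ℝ, E) 𝓘(ℝ, ℝ) ∞ u (chartAt E (c i)).source → ∀ x, b i x ≠ 0 →
        MDifferentiableAt 𝓘(ℝ, E) 𝓘(ℝ, ℝ) u x := fun {i u} hu x hx =>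
    ((hu.contMDiffAt ((chartAt E (c i)).open_source.mem_nhds
      ((b i).support_subset_source hx))).mdifferentiableAt (by simp))
  have hrep : ∀ i k, IsRepresentable K fun (x : M) (v : E) =>
      b i x ^ 2 * (a i k x * diff (y i k) x v) := fun i k =>
    IsRepresentable.mul_diff (b i).contMDiff ((b i).contMDiff_smul (has i k))
      ((b i).contMDiff_smul (hys i k)) ((b i).contMDiff_smul ((has i k).mul (hys i k)))
      (hmd (has i k)) (hmd (hys i k))
  have hpos : ∀ x ∈ K, 0 < ∑ i, b i x ^ 2 := fun x hx => by
    obtain ⟨i, hi⟩ := hb x hx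
    refine Finset.sum_pos' (fun i _ => sq_nonneg _) ⟨i, Finset.mem_univ i, ?_⟩
    rw [hi.self_of_nhds]; norm_num
  have hS : ContMDiff 𝓘(ℝ, E) 𝓘(ℝ, ℝ) ∞ fun x => ∑ i, b i x ^ 2 :=
    contMDiff_finsetSum fun i _ => (b i).contMDiff.pow 2
  -- The local forms sum to $\sum_i b_i^2$ times the target; dividing by this sum means scaling by
  -- the square of its inverse square root, which is smooth at points of `K`.
  refine ((IsRepresentable.sum Finset.univ fun i =>
    IsRepresentable.sum Finset.univ (hrep i)).sq_mul (s := fun x => (√(∑ i, b i x ^ 2))⁻¹)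
    fun x hx => ?_).congr fun x hx v => ?_
  · have h1 : ContDiffAt ℝ ∞ (fun s : ℝ => (√s)⁻¹) (∑ i, b i x ^ 2) :=
      (Real.contDiffAt_sqrt (hpos x hx).ne').inv (Real.sqrt_ne_zero'.2 (hpos x hx))
    exact ContMDiffAt.comp x (g := fun s : ℝ => (√s)⁻¹) h1.contMDiffAt hS.contMDiffAt
  · have key : ∀ i, ∑ k, b i x ^ 2 * (a i k x * diff (y i k) x v) =
        b i x ^ 2 * (diff φ x (Complex.I • v) / 2) := by
      intro i
      by_cases hbx : b i x = 0
      · simp [hbx]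
      have hsx := (b i).support_subset_source hbx
      obtain ⟨T, hT, -⟩ := exists_hasMFDerivAt_chartAt (c i) hsx
      have h1 : ∀ k, diff (y i k) x v = ℓ k (T v) := fun k =>
        diff_eq (L := (ℓ k).comp (T.restrictScalars ℝ))
          (HasMFDerivWithinAt.vector_clm_comp (ℓ k) (hasMFDerivWithinAt_univ.2 hT)) v
      have h2 : HasFDerivAt (Φ i) (fderiv ℝ (Φ i) (chartAt E (c i) x)) (chartAt E (c i) x) :=
        (((hΦs i).differentiableOn (by simp)).differentiableAt
          ((chartAt E (c i)).open_target.mem_nhds ((chartAt E (c i)).map_source hsx))).hasFDerivAt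
      have h3 := h2.hasMFDerivAt.comp x hT
      have h4 : diff φ x (Complex.I • v) = fderiv ℝ (Φ i) (chartAt E (c i) x) (T (Complex.I • v)) := by
        refine diff_eq (L := (fderiv ℝ (Φ i) (chartAt E (c i) x)).comp (T.restrictScalars ℝ))
          (hasMFDerivWithinAt_univ.2 (h3.congr_of_eventuallyEq ?_)) _
        filter_upwards [(chartAt E (c i)).open_source.mem_nhds hsx] with z hz
        simp [hΦ, (chartAt E (c i)).left_inv hz]
      -- Complex linearity of the chart differential `T` moves `Complex.I` outside, which is where
      -- holomorphy of the charts enters.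
      rw [h4, map_smul, ← Finset.mul_sum]
      congr 1
      conv_rhs => rw [← hsum (T v), Finset.smul_sum, map_sum, Finset.sum_div]
      refine Finset.sum_congr rfl fun k _ => ?_
      rw [h1, smul_comm, map_smul, smul_eq_mul]
      ring
    simp only [key]
    rw [← Finset.sum_mul, inv_pow, Real.sq_sqrt (hpos x hx).le, inv_mul_cancel_left₀ (hpos x hx).ne']

end Compact

/-! ### Smooth maps given by finitely many components -/

section Span

variable {F : Type*} [NormedAddCommGroup F] [NormedSpace ℝ F] {H : Type*} [TopologicalSpace H]
  {I : ModelWithCorners ℝ F H} {N : Type*} [TopologicalSpace N] [ChartedSpace H N]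
  {E' : Type*} [NormedAddCommGroup E'] [NormedSpace ℂ E'] {κ : Type*} [Fintype κ]
  {S : Set N} {p : N}

theorem contMDiffOn_sum_smul_const {u : κ → N → ℂ} (e : κ → E')
    (hu : ∀ k, ContMDiffOn I 𝓘(ℝ, ℂ) ∞ (u k) S) :
    ContMDiffOn I 𝓘(ℝ, E') ∞ (fun q => ∑ k, u k q • e k) S :=
  contMDiffOn_finsetSum fun k _ =>
    (((ContinuousLinearMap.toSpanSingleton ℂ (e k)).restrictScalars ℝ).contMDiff).comp_contMDiffOn
      (hu k)

theorem exists_hasMFDerivWithinAt_sum_smul_const {u : κ → N → ℂ} {L : κ → F →L[ℝ] ℂ} (e : κ → E')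
    (hu : ∀ k, HasMFDerivWithinAt I 𝓘(ℝ, ℂ) (u k) S p (L k)) :
    ∃ L' : F →L[ℝ] E', HasMFDerivWithinAt I 𝓘(ℝ, E') (fun q => ∑ k, u k q • e k) S p L' ∧
      ∀ w, L' w = ∑ k, L k w • e k := by
  refine ⟨∑ k, ((ContinuousLinearMap.toSpanSingleton ℂ (e k)).restrictScalars ℝ).comp (L k),
    ?_, fun w => by simp⟩
  rw [hasMFDerivWithinAt_vector_iff]
  have h := fun k => hasMFDerivWithinAt_vector_iff.1 (HasMFDerivWithinAt.vector_clm_comp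
    ((ContinuousLinearMap.toSpanSingleton ℂ (e k)).restrictScalars ℝ) (hu k))
  exact ⟨tendsto_finsetSum _ fun k _ => (h k).1, HasFDerivWithinAt.fun_sum fun k _ => (h k).2⟩

end Span

/-! ### From embedding tuples to contact embeddings in the sphere -/

section Tuple

variable {E : Type*} [NormedAddCommGroup E] [NormedSpace ℂ E]
  {M : Type*} [TopologicalSpace M] [ChartedSpace E M]

/-- The model of `ℂ × M` as a real manifold. -/
abbrev totalModel (E : Type*) [NormedAddCommGroup E] [NormedSpace ℂ E] :
    ModelWithCorners ℝ (ℂ × E) (ModelProd ℂ E) :=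
  𝓘(ℝ, ℂ).prod 𝓘(ℝ, E)

/-- The coordinate $t$ itself accounts for the first summand, so a tuple only has to produce the
second. -/
theorem contactForm_eq (φ : M → ℝ) (p : ℂ × M) (v : ℂ × E) :
    contactForm φ p v = (conj p.1 * v.1).im + diff φ p.2 (Complex.I • v.2) / 2 := by
  simp only [contactForm]
  simp
  ring

/-- A finite family of invariant complex functions on `X` with `∑ Im (v̄ dv) = ½ dφ ∘ J`, which
separate the points and the tangent vectors of the base even up to real scaling. -/
structure IsEmbeddingTuple (φ : M → ℝ) {κ : Type*} [Fintype κ] (v : κ → ℂ × M → ℂ) : Prop where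
  smooth : ∀ k, ContMDiffOn (totalModel E) 𝓘(ℝ, ℂ) ∞ (v k) (ballBoundary φ)
  invariant : ∀ k, ∀ c : Circle, ∀ p ∈ ballBoundary φ, v k (rot c p) = v k p
  separates : ∀ p ∈ ballBoundary φ, ∀ q ∈ ballBoundary φ, ∀ s : ℝ,
    (∀ k, v k p = s • v k q) → s = 1 ∧ p.2 = q.2
  deriv : ∀ p ∈ ballBoundary φ, ∃ L : κ → ℂ × E →L[ℝ] ℂ,
    (∀ k, HasMFDerivWithinAt (totalModel E) 𝓘(ℝ, ℂ) (v k) (ballBoundary φ) p (L k)) ∧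
    (∀ w, IsTangent φ p w →
      ∑ k, (conj (v k p) * L k w).im = diff φ p.2 (Complex.I • w.2) / 2) ∧
    ∀ w, ∀ s : ℝ, (∀ k, L k w = s • v k p) → s = 0 ∧ w.2 = 0

namespace IsEmbeddingTuple

variable {φ : M → ℝ} {κ : Type*} [Fintype κ] {v : κ → ℂ × M → ℂ}

/-- Extension of an embedding tuple by zeros. -/
theorem extend {κ' : Type*} [Fintype κ'] (hv : IsEmbeddingTuple (E := E) φ v) (e : κ ↪ κ') :
    IsEmbeddingTuple (E := E) φ (Function.extend e v fun _ _ => 0) := by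
  have hin : ∀ k, Function.extend e v (fun _ _ => 0) (e k) = v k :=
    fun k => e.injective.extend_apply _ _ k
  have hout : ∀ j, (¬ ∃ k, e k = j) → Function.extend e v (fun _ _ => 0) j = fun _ => 0 :=
    fun j hj => Function.extend_apply' _ _ j hj
  refine ⟨fun j => ?_, fun j c p hp => ?_, fun p hp q hq s h => ?_, fun p hp => ?_⟩
  · by_cases hj : ∃ k, e k = j
    · obtain ⟨k, rfl⟩ := hj
      rw [hin]; exact hv.smooth k
    · rw [hout j hj]; exact contMDiffOn_const
  · by_cases hj : ∃ k, e k = j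
    · obtain ⟨k, rfl⟩ := hj
      rw [hin]; exact hv.invariant k c p hp
    · rw [hout j hj]
  · exact hv.separates p hp q hq s fun k => by simpa only [hin] using h (e k)
  · obtain ⟨L, hL, hc, hi⟩ := hv.deriv p hp
    have hLin : ∀ k, Function.extend e L (fun _ => 0) (e k) = L k :=
      fun k => e.injective.extend_apply _ _ k
    have hLout : ∀ j, (¬ ∃ k, e k = j) → Function.extend e L (fun _ => 0) j = 0 :=
      fun j hj => Function.extend_apply' _ _ j hj
    refine ⟨Function.extend e L fun _ => 0, fun j => ?_, fun w hw => ?_, fun w s h => ?_⟩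
    · by_cases hj : ∃ k, e k = j
      · obtain ⟨k, rfl⟩ := hj
        rw [hin, hLin]; exact hL k
      · rw [hout j hj, hLout j hj]; exact hasMFDerivWithinAt_const _ _ _
    · rw [← hc w hw]
      refine (Fintype.sum_of_injective e e.injective _ _ (fun j hj => ?_) fun k => ?_).symm
      · rw [hout j hj]; simp
      · rw [hin, hLin]
    · exact hi w s fun k => by simpa only [hin, hLin] using h (e k)

end IsEmbeddingTuple

/-- The factor which scales `(t, v)` to the unit sphere. -/
def scaleFactor {κ : Type*} [Fintype κ] (v : κ → ℂ × M → ℂ) (p : ℂ × M) : ℝ :=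
  (√(‖p.1‖ ^ 2 + ∑ k, ‖v k p‖ ^ 2))⁻¹

/-- The map to the unit sphere given by `(t, v)`. -/
def sphereMap {N : ℕ} (v : Fin N → ℂ × M → ℂ) (p : ℂ × M) : ℂ × EuclideanSpace ℂ (Fin N) :=
  (scaleFactor v p • p.1, ∑ k, (scaleFactor v p • v k p) • EuclideanSpace.single k (1 : ℂ))

theorem sum_smul_single {N : ℕ} (z : Fin N → ℂ) :
    ∑ k, z k • EuclideanSpace.single k (1 : ℂ) = WithLp.toLp 2 z := by
  ext j
  simp [Finset.sum_apply, Pi.single_apply]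

namespace IsEmbeddingTuple

variable {φ : M → ℝ} {κ : Type*} [Fintype κ] {v : κ → ℂ × M → ℂ}

theorem normSq_pos (hv : IsEmbeddingTuple (E := E) φ v) {p : ℂ × M} (hp : p ∈ ballBoundary φ) :
    0 < ‖p.1‖ ^ 2 + ∑ k, ‖v k p‖ ^ 2 := by
  refine add_pos_of_nonneg_of_pos (sq_nonneg _) ?_
  by_contra h
  have h0 : ∀ k, v k p = 0 := fun k => by
    have h1 := (Finset.sum_eq_zero_iff_of_nonneg (fun k _ => sq_nonneg ‖v k p‖)).1
      (le_antisymm (not_lt.1 h) (Finset.sum_nonneg fun k _ => sq_nonneg _)) k (Finset.mem_univ k)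
    simpa using h1
  -- A tuple vanishing at `p` would equal its own double, against separation up to scaling.
  have := (hv.separates p hp p hp 2 fun k => by simp [h0]).1
  norm_num at this

theorem scaleFactor_pos (hv : IsEmbeddingTuple (E := E) φ v) {p : ℂ × M}
    (hp : p ∈ ballBoundary φ) : 0 < scaleFactor v p :=
  inv_pos.2 (Real.sqrt_pos.2 (hv.normSq_pos hp))

theorem contMDiffOn_scaleFactor (hv : IsEmbeddingTuple (E := E) φ v) :
    ContMDiffOn (totalModel E) 𝓘(ℝ, ℝ) ∞ (scaleFactor v) (ballBoundary φ) := by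
  have hn : ContMDiff 𝓘(ℝ, ℂ) 𝓘(ℝ, ℝ) ∞ fun z : ℂ => ‖z‖ ^ 2 := (contDiff_norm_sq ℝ).contMDiff
  have h1 : ContMDiffOn (totalModel E) 𝓘(ℝ, ℝ) ∞
      (fun p : ℂ × M => ‖p.1‖ ^ 2 + ∑ k, ‖v k p‖ ^ 2) (ballBoundary φ) :=
    (hn.comp contMDiff_fst).contMDiffOn.add
      (contMDiffOn_finsetSum fun k _ => hn.comp_contMDiffOn (hv.smooth k))
  intro p hp
  have h2 : ContDiffAt ℝ ∞ (fun s : ℝ => (√s)⁻¹) (‖p.1‖ ^ 2 + ∑ k, ‖v k p‖ ^ 2) :=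
    (Real.contDiffAt_sqrt (hv.normSq_pos hp).ne').inv (Real.sqrt_ne_zero'.2 (hv.normSq_pos hp))
  exact ContMDiffAt.comp_contMDiffWithinAt p (g := fun s : ℝ => (√s)⁻¹) h2.contMDiffAt (h1 p hp)

variable {N : ℕ} {v : Fin N → ℂ × M → ℂ}

/-- Differentiating the scale factor only adds a real multiple `l w` of the radial vector $(t,v)$,
which is invisible to the contact form and handled by the scaling clause in the immersion condition.
-/
theorem exists_hasDerivOn_sphereMap (hv : IsEmbeddingTuple (E := E) φ v) {p : ℂ × M}
    (hp : p ∈ ballBoundary φ) {L : Fin N → ℂ × E →L[ℝ] ℂ}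
    (hL : ∀ k, HasMFDerivWithinAt (totalModel E) 𝓘(ℝ, ℂ) (v k) (ballBoundary φ) p (L k)) :
    ∃ (L' : ℂ × E →L[ℝ] ℂ × EuclideanSpace ℂ (Fin N)) (l : ℂ × E →L[ℝ] ℝ),
      HasDerivOn (E := E) (E' := EuclideanSpace ℂ (Fin N)) (sphereMap v) (ballBoundary φ) p L' ∧
      ∀ w, (L' w).1 = scaleFactor v p • w.1 + l w • p.1 ∧
        (L' w).2 = WithLp.toLp 2 fun k => scaleFactor v p • L k w + l w • v k p := by
  obtain ⟨l, hl⟩ : ∃ l : ℂ × E →L[ℝ] ℝ,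
      HasMFDerivWithinAt (totalModel E) 𝓘(ℝ, ℝ) (scaleFactor v) (ballBoundary φ) p l :=
    ⟨_, ((hv.contMDiffOn_scaleFactor p hp).mdifferentiableWithinAt
      (by simp)).hasMFDerivWithinAt⟩
  have h1 := HasMFDerivWithinAt.vector_smul (L := ContinuousLinearMap.fst ℝ ℂ E) hl
    (hasMFDerivWithinAt_fst (I := 𝓘(ℝ, ℂ)) (I' := 𝓘(ℝ, E)) (s := ballBoundary φ) (x := p))
  obtain ⟨L₂, hL₂, hL₂'⟩ := exists_hasMFDerivWithinAt_sum_smul_const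
    (fun k => EuclideanSpace.single k (1 : ℂ))
    (fun k => HasMFDerivWithinAt.vector_smul hl (hL k))
  refine ⟨_, l, h1.prodMk hL₂, fun w => ⟨rfl, ?_⟩⟩
  exact (hL₂' w).trans (sum_smul_single _)

theorem isContactEmbedding (hv : IsEmbeddingTuple (E := E) φ v) :
    IsContactEmbedding (E := E) φ (sphereMap v) := by
  refine ⟨fun p hp => ?_, ?_, fun p hp q hq h => ?_, fun p hp => ?_, fun p hp => ?_,
    fun c p hp => ?_⟩
  · rw [mem_ballBoundary_sphereFn]
    simp only [sphereMap, sum_smul_single, EuclideanSpace.norm_sq_eq, norm_smul, mul_pow]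
    rw [← Finset.mul_sum, ← mul_add, Real.norm_eq_abs, sq_abs, scaleFactor, inv_pow,
      Real.sq_sqrt (hv.normSq_pos hp).le, inv_mul_cancel₀ (hv.normSq_pos hp).ne']
  · exact (hv.contMDiffOn_scaleFactor.smul contMDiff_fst.contMDiffOn).prodMk
      (contMDiffOn_sum_smul_const _ fun k => hv.contMDiffOn_scaleFactor.smul (hv.smooth k))
  · simp only [sphereMap, sum_smul_single, Prod.mk.injEq] at h
    have hpp := hv.scaleFactor_pos hp
    have key : ∀ a b : ℂ, scaleFactor v p • a = scaleFactor v q • b →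
        a = ((scaleFactor v p)⁻¹ * scaleFactor v q) • b := fun a b hab => by
      rw [mul_smul, ← hab, inv_smul_smul₀ hpp.ne']
    -- Equal images make the two tuples proportional; separation makes the ratio $1$, and then the
    -- $t$ coordinates agree as well.
    have h2 := hv.separates p hp q hq _ fun k => key _ _ (congrArg (fun z => z.ofLp k) h.2)
    refine Prod.ext ?_ h2.2
    rw [key _ _ h.1, h2.1, one_smul]
  · obtain ⟨L, hL, -, hi⟩ := hv.deriv p hp
    obtain ⟨L', l, hL', hw⟩ := hv.exists_hasDerivOn_sphereMap hp hL
    refine ⟨L', hL', fun w _ h => ?_⟩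
    have hpp := (hv.scaleFactor_pos hp).ne'
    have key : ∀ a b : ℂ, scaleFactor v p • a + l w • b = 0 →
        a = (-((scaleFactor v p)⁻¹ * l w)) • b := fun a b hab => by
      rw [neg_smul, mul_smul, eq_neg_of_add_eq_zero_right hab, smul_neg, inv_smul_smul₀ hpp, neg_neg]
    have h1 : scaleFactor v p • w.1 + l w • p.1 = 0 := by rw [← (hw w).1, h]; rfl
    have h2 : ∀ k, scaleFactor v p • L k w + l w • v k p = 0 := fun k => by
      have := congrArg (fun z => z.ofLp k) (hw w).2
      simp only [h] at this
      exact this.symm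
    obtain ⟨h3, h4⟩ := hi w _ fun k => key _ _ (h2 k)
    refine Prod.ext ?_ h4
    rw [key _ _ h1, h3, zero_smul]; rfl
  · obtain ⟨L, hL, hc, -⟩ := hv.deriv p hp
    obtain ⟨L', l, hL', hw⟩ := hv.exists_hasDerivOn_sphereMap hp hL
    refine ⟨L', hL', scaleFactor v p ^ 2, pow_pos (hv.scaleFactor_pos hp) 2, fun w ht => ?_⟩
    rw [contactForm_sphereFn, contactForm_eq, (hw w).1, (hw w).2, ← hc w ht]
    simp only [sphereMap, sum_smul_single]
    rw [Complex.add_im, im_conj_smul_mul, mul_add, Finset.mul_sum]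
    congr 1
    rw [PiLp.inner_apply, Complex.im_sum]
    refine Finset.sum_congr rfl fun k _ => ?_
    rw [← im_conj_smul_mul _ (l w)]
    simp [mul_comm]
  · have h1 : scaleFactor v (rot c p) = scaleFactor v p := by
      simp only [scaleFactor, hv.invariant _ c p hp]
      rw [rot, norm_mul, Circle.norm_coe, one_mul]
    simp only [sphereMap, h1, hv.invariant _ c p hp]
    simp [rot, mul_left_comm]

theorem pullsBackCoordinate (hv : IsEmbeddingTuple (E := E) φ v) :
    PullsBackCoordinate (E := E) φ (sphereMap v) :=
  ⟨scaleFactor v, hv.contMDiffOn_scaleFactor, fun _ hp => ⟨hv.scaleFactor_pos hp,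
    Complex.real_smul⟩⟩

end IsEmbeddingTuple

end Tuple

/-! ### The hypersurface $X$, its tangent vectors and local parametrizations -/

theorem HasMFDerivWithinAt.hasFDerivAt_comp {F F' : Type*} [NormedAddCommGroup F] [NormedSpace ℝ F]
    [NormedAddCommGroup F'] [NormedSpace ℝ F']
    {H : Type*} [TopologicalSpace H] {I : ModelWithCorners ℝ F H} {N : Type*} [TopologicalSpace N]
    [ChartedSpace H N] {V : Type*} [NormedAddCommGroup V] [NormedSpace ℝ V] {S : Set N} {u : N → V}
    {L : F →L[ℝ] V} {κ : F' → N} {y : F'} {K : F' →L[ℝ] F}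
    (hu : HasMFDerivWithinAt I 𝓘(ℝ, V) u S (κ y) L) (hκ : HasMFDerivAt 𝓘(ℝ, F') I κ y K)
    (hS : ∀ᶠ z in 𝓝 y, κ z ∈ S) : HasFDerivAt (fun z => u (κ z)) (L.comp K) y := by
  have h1 : HasMFDerivWithinAt 𝓘(ℝ, F') 𝓘(ℝ, V) (u ∘ κ) (κ ⁻¹' S) y (L.comp K) :=
    HasMFDerivWithinAt.comp y hu hκ.hasMFDerivWithinAt le_rfl
  exact (h1.hasMFDerivAt hS).hasFDerivAt

/-- The equation `|t|² - φ` of `X`. -/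
def levelFn {M : Type*} (φ : M → ℝ) (p : ℂ × M) : ℝ := ‖p.1‖ ^ 2 - φ p.2

theorem levelFn_eq_zero_iff {M : Type*} {φ : M → ℝ} {p : ℂ × M} :
    levelFn φ p = 0 ↔ p ∈ ballBoundary φ := sub_eq_zero

theorem nonneg_of_mem_ballBoundary {M : Type*} {φ : M → ℝ} {p : ℂ × M}
    (hp : p ∈ ballBoundary φ) : 0 ≤ φ p.2 := by
  have : ‖p.1‖ ^ 2 = φ p.2 := hp
  rw [← this]; positivity

section Hypersurface

variable {E : Type*} [NormedAddCommGroup E] [NormedSpace ℂ E]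
  {M : Type*} [TopologicalSpace M] [ChartedSpace E M] {φ : M → ℝ}

theorem contMDiff_levelFn (hφ : ContMDiff 𝓘(ℝ, E) 𝓘(ℝ, ℝ) ∞ φ) :
    ContMDiff (totalModel E) 𝓘(ℝ, ℝ) ∞ (levelFn φ) := by
  have hn : ContMDiff 𝓘(ℝ, ℂ) 𝓘(ℝ, ℝ) ∞ fun z : ℂ => ‖z‖ ^ 2 := (contDiff_norm_sq ℝ).contMDiff
  exact (hn.comp contMDiff_fst).sub (hφ.comp contMDiff_snd)

theorem exists_hasMFDerivAt_levelFn (hφ : ContMDiff 𝓘(ℝ, E) 𝓘(ℝ, ℝ) ∞ φ) (p : ℂ × M) :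
    ∃ ℓ : ℂ × E →L[ℝ] ℝ, HasMFDerivAt (totalModel E) 𝓘(ℝ, ℝ) (levelFn φ) p ℓ ∧
      ∀ w, IsTangent φ p w ↔ ℓ w = 0 := by
  obtain ⟨D, hD, hD'⟩ := exists_hasMFDerivAt_diff (hφ.mdifferentiable (by simp) p.2)
  have h1 := (hasStrictFDerivAt_norm_sq p.1).hasFDerivAt.hasMFDerivAt.comp p
    (hasMFDerivAt_fst (I := 𝓘(ℝ, ℂ)) (I' := 𝓘(ℝ, E)) p)
  have h2 := (hasMFDerivWithinAt_univ.1 hD).comp p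
    (hasMFDerivAt_snd (I := 𝓘(ℝ, ℂ)) (I' := 𝓘(ℝ, E)) p)
  refine ⟨_, h1.sub h2, fun w => ?_⟩
  have h3 : ∀ a b : ℝ, a = b → (a = 0 ↔ b = 0) := fun a b h => by rw [h]
  refine h3 _ _ ?_
  rw [hD']
  change _ = (2 : ℕ) • (inner ℝ p.1 w.1 : ℝ) - D w.2
  simp [Complex.inner]
  ring

/-- Regularity of $|t|^2-\phi$ on $X$: where $t=0$ it comes from $d\phi\neq0$, elsewhere from the
radial direction in $t$. -/
theorem IsPseudoconvexDefining.exists_not_isTangent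
    (hφ : IsPseudoconvexDefining (E := E) φ) {p : ℂ × M} (hp : p ∈ ballBoundary φ) :
    ∃ w : ℂ × E, ¬ IsTangent φ p w := by
  obtain ⟨D, -, hD⟩ := exists_hasMFDerivAt_diff (hφ.smooth.mdifferentiable (by simp) p.2)
  by_cases ht : p.1 = 0
  · have h0 : φ p.2 = 0 := by simpa [ballBoundary, ht, eq_comm] using hp
    obtain ⟨v, hv⟩ := hφ.regular _ h0
    exact ⟨(0, v), by simpa [IsTangent] using hv⟩
  · refine ⟨(p.1, 0), ?_⟩
    simp only [IsTangent, hD, map_zero]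
    simpa [← Complex.normSq_eq_conj_mul_self] using ht

theorem IsPseudoconvexDefining.exists_contactForm_ne_zero
    (hφ : IsPseudoconvexDefining (E := E) φ) {p : ℂ × M} (hp : p ∈ ballBoundary φ) :
    ∃ w : ℂ × E, IsTangent φ p w ∧ contactForm φ p w ≠ 0 := by
  obtain ⟨D, -, hD⟩ := exists_hasMFDerivAt_diff (hφ.smooth.mdifferentiable (by simp) p.2)
  by_cases ht : p.1 = 0
  · have h0 : φ p.2 = 0 := by simpa [ballBoundary, ht, eq_comm] using hp
    obtain ⟨v, hv⟩ := hφ.regular _ h0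
    rw [hD] at hv
    -- The multiple of $v$ is subtracted to make the vector tangent; the form then takes the value
    -- $-(d\phi(v)^2+d\phi(iv)^2)/(2\,d\phi(v))$.
    refine ⟨(0, Complex.I • v - (D (Complex.I • v) / D v) • v), ?_, ?_⟩
    · simp only [IsTangent, hD, map_sub, map_smul]
      simp [hv]
    · have h1 : Complex.I • (Complex.I • v - (D (Complex.I • v) / D v) • v) =
          -v - (D (Complex.I • v) / D v) • (Complex.I • v) := by
        rw [smul_sub, smul_smul, Complex.I_mul_I, neg_one_smul, smul_comm]
      rw [contactForm_eq]
      simp only [ht, h1, hD, map_sub, map_smul, map_neg, smul_eq_mul]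
      simp only [map_zero, mul_zero, Complex.zero_im, zero_add]
      have h2 : (-D v - D (Complex.I • v) / D v * D (Complex.I • v)) / 2 =
          -(D v ^ 2 + D (Complex.I • v) ^ 2) / (2 * D v) := by
        field_simp
        ring
      rw [h2]
      have : 0 < D v ^ 2 + D (Complex.I • v) ^ 2 := by positivity
      exact div_ne_zero (neg_ne_zero.2 this.ne') (by simpa using hv)
  · refine ⟨(Complex.I * p.1, 0), ?_, ?_⟩
    · simp only [IsTangent, hD, map_zero]
      simp
      ring
    · rw [contactForm_eq, smul_zero, hD, map_zero]
      rw [mul_left_comm, ← Complex.normSq_eq_conj_mul_self]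
      simpa using ht

variable [FiniteDimensional ℂ E] [IsManifold 𝓘(ℂ, E) ω M]

/-- Local parametrizations of `X`. -/
theorem IsPseudoconvexDefining.exists_parametrization
    (hφ : IsPseudoconvexDefining (E := E) φ) {p : ℂ × M} (hp : p ∈ ballBoundary φ) :
    ∃ (κ : ℂ × E → ℂ × M) (K : ℂ × E →L[ℝ] ℂ × E) (y₀ : ℂ × E),
      y₀ = extChartAt (totalModel E) p p ∧
      ContMDiffAt 𝓘(ℝ, ℂ × E) (totalModel E) ∞ κ y₀ ∧
      (∀ᶠ y in 𝓝 y₀, κ y ∈ ballBoundary φ ∧ ∃ L : ℂ × E →L[ℝ] ℂ × E,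
        HasMFDerivAt 𝓘(ℝ, ℂ × E) (totalModel E) κ y L ∧ ∀ v, IsTangent φ (κ y) (L v)) ∧
      (∀ᶠ q in 𝓝 p, q ∈ ballBoundary φ → κ (extChartAt (totalModel E) p q) = q) ∧
      κ y₀ = p ∧ HasMFDerivAt 𝓘(ℝ, ℂ × E) (totalModel E) κ y₀ K ∧
      ∀ v, IsTangent φ p v → K v = v := by
  have : IsManifold 𝓘(ℝ, E) ∞ M := isManifold_real
  have : FiniteDimensional ℝ E := FiniteDimensional.complexToReal E
  have : CompleteSpace (ℂ × E) := FiniteDimensional.complete ℝ _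
  obtain ⟨ℓ, hℓ, hℓt⟩ := exists_hasMFDerivAt_levelFn hφ.smooth p
  obtain ⟨w, hw⟩ := hφ.exists_not_isTangent hp
  obtain ⟨κ, h1, h2, h3, h4, h5, K, hK, hK'⟩ := exists_local_parametrization (totalModel E)
    (contMDiff_levelFn hφ.smooth) p (levelFn_eq_zero_iff.2 hp) hℓ
    (fun h => hw ((hℓt w).2 (by rw [h]; rfl)))
  refine ⟨κ, K, _, rfl, h1, ?_, ?_, h5, hK, fun v hv => hK' v ((hℓt v).1 hv)⟩
  · filter_upwards [h2, eventually_eventually_nhds.2 h3] with y hy hy'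
    refine ⟨levelFn_eq_zero_iff.1 hy'.self_of_nhds, mfderiv 𝓘(ℝ, ℂ × E) (totalModel E) κ y,
      hy.hasMFDerivAt, fun v => ?_⟩
    obtain ⟨ℓ', hℓ', hℓt'⟩ := exists_hasMFDerivAt_levelFn hφ.smooth (κ y)
    rw [hℓt']
    have h6 := HasMFDerivWithinAt.hasFDerivAt_comp (hasMFDerivWithinAt_univ.2 hℓ')
      hy.hasMFDerivAt (by simp)
    -- The equation of $X$ vanishes identically along `κ`, so its differential kills the image of
    -- `L`.
    have h7 : HasFDerivAt (fun z => levelFn φ (κ z)) (0 : ℂ × E →L[ℝ] ℝ) y :=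
      (hasFDerivAt_const (0 : ℝ) y).congr_of_eventuallyEq hy'
    exact congrArg (fun T : ℂ × E →L[ℝ] ℝ => T v) (h6.unique h7)
  · filter_upwards [h4] with q hq hqX
    exact hq (levelFn_eq_zero_iff.2 hqX)

/-- Derivatives within a piece of `X` are unique on the tangent vectors. -/
theorem IsPseudoconvexDefining.deriv_unique (hφ : IsPseudoconvexDefining (E := E) φ)
    {V : Type*} [NormedAddCommGroup V] [NormedSpace ℝ V] {O : Set (ℂ × M)} (hO : IsOpen O)
    {p : ℂ × M} (hp : p ∈ O ∩ ballBoundary φ) {u : ℂ × M → V} {L L' : ℂ × E →L[ℝ] V}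
    (hL : HasMFDerivWithinAt (totalModel E) 𝓘(ℝ, V) u (O ∩ ballBoundary φ) p L)
    (hL' : HasMFDerivWithinAt (totalModel E) 𝓘(ℝ, V) u (O ∩ ballBoundary φ) p L')
    {w : ℂ × E} (hw : IsTangent φ p w) : L w = L' w := by
  obtain ⟨κ, K, y₀, -, h1, h2, -, h4, hK, hK'⟩ := hφ.exists_parametrization hp.2
  have hS : ∀ᶠ y in 𝓝 y₀, κ y ∈ O ∩ ballBoundary φ := by
    filter_upwards [h2, h1.continuousAt.eventually (hO.mem_nhds (by rw [h4]; exact hp.1))] with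
      y hy hyO using ⟨hyO, hy.1⟩
  have h5 := (HasMFDerivWithinAt.hasFDerivAt_comp (L := L) (by rw [h4]; exact hL) hK hS).unique
    (HasMFDerivWithinAt.hasFDerivAt_comp (L := L') (by rw [h4]; exact hL') hK hS)
  simpa [hK' w hw] using congrArg (fun T : ℂ × E →L[ℝ] V => T w) h5

end Hypersurface

/-! ### The contact form as $\sum\operatorname{Im}(\bar W\,dW)$ -/

section Primitive

variable {E : Type*} [NormedAddCommGroup E] [NormedSpace ℂ E] [FiniteDimensional ℂ E]
  {M : Type*} [TopologicalSpace M] [T2Space M] [ChartedSpace E M] [IsManifold 𝓘(ℂ, E) ω M]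
  {φ : M → ℝ}

/-- The contact form of `X` is `∑ Im (W̄ dW)` for finitely many smooth functions `W`. -/
theorem IsPseudoconvexDefining.exists_primitive (hφ : IsPseudoconvexDefining (E := E) φ) :
    ∃ (ι : Type) (_ : Fintype ι) (W : ι → ℂ × M → ℂ), ∀ p ∈ ballBoundary φ,
      (∀ k, ContMDiffAt (totalModel E) 𝓘(ℝ, ℂ) ∞ (W k) p) ∧
      ∃ L : ι → ℂ × E →L[ℝ] ℂ, (∀ k, HasMFDerivAt (totalModel E) 𝓘(ℝ, ℂ) (W k) p (L k)) ∧
        ∀ w, ∑ k, (conj (W k p) * L k w).im = contactForm φ p w := by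
  obtain ⟨ι, _, u, hu, hβ⟩ := isRepresentable_diff_I hφ.smooth hφ.isCompact_nonneg
  refine ⟨Option ι, inferInstance, fun k p => k.elim p.1 fun i => u i p.2, fun p hp => ⟨?_, ?_⟩⟩
  · rintro (_ | i)
    · exact contMDiffAt_fst
    · exact ContMDiffAt.comp p (hu i _ (nonneg_of_mem_ballBoundary hp)) contMDiffAt_snd
  · have h1 := fun i => exists_hasMFDerivAt_cdiff
      ((hu i p.2 (nonneg_of_mem_ballBoundary hp)).mdifferentiableAt (by simp))
    choose L hL hL' using h1
    refine ⟨fun k => k.elim (ContinuousLinearMap.fst ℝ ℂ E)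
      fun i => (L i).comp (ContinuousLinearMap.snd ℝ ℂ E), ?_, fun w => ?_⟩
    · rintro (_ | i)
      · exact hasMFDerivAt_fst (I := 𝓘(ℝ, ℂ)) (I' := 𝓘(ℝ, E)) p
      · exact (hasMFDerivWithinAt_univ.1 (hL i)).comp p (hasMFDerivAt_snd (I := 𝓘(ℝ, ℂ)) (I' := 𝓘(ℝ, E)) p)
    · rw [contactForm_eq]
      refine Eq.trans ?_ (congrArg _ (hβ _ (nonneg_of_mem_ballBoundary hp) w.2))
      simp [Fintype.sum_option, hL']

end Primitive

/-! ### The generator of the circle action -/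

section Rotation

variable {E : Type*} [NormedAddCommGroup E] [NormedSpace ℂ E]
  {M : Type*} [TopologicalSpace M] [ChartedSpace E M]

/-- The velocity of a rotation orbit. -/
theorem hasMFDerivAt_rot (p : ℂ × M) :
    ∃ Γ : ℝ →L[ℝ] ℂ × E, HasMFDerivAt 𝓘(ℝ, ℝ) (totalModel E)
      (fun θ : ℝ => rot (Circle.exp θ) p) 0 Γ ∧ Γ 1 = (Complex.I * p.1, 0) := by
  have h1 : HasDerivAt (fun θ : ℝ => (Circle.exp θ : ℂ) * p.1) (Complex.I * p.1) 0 := by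
    have h2 : HasDerivAt (fun θ : ℝ => (θ : ℂ) * Complex.I) (1 * Complex.I) 0 :=
      (Complex.ofRealCLM.hasDerivAt (x := (0 : ℝ))).mul_const Complex.I
    have h3 := (h2.cexp).mul_const p.1
    simpa [Circle.coe_exp] using h3
  refine ⟨(ContinuousLinearMap.toSpanSingleton ℝ (Complex.I * p.1)).prod 0, ?_, ?_⟩
  · exact (h1.hasFDerivAt.hasMFDerivAt).prodMk (hasMFDerivAt_const p.2 (0 : ℝ))
  · simp

variable {E' : Type*} [NormedAddCommGroup E'] [NormedSpace ℂ E']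
  {M' : Type*} [TopologicalSpace M'] [ChartedSpace E' M']

/-- An equivariant map sends the generator of the rotations to the generator of the rotations. -/
theorem HasDerivOn.map_rot {S : Set (ℂ × M)} {F : ℂ × M → ℂ × M'} {p : ℂ × M}
    {L : ℂ × E →L[ℝ] ℂ × E'} (hL : HasDerivOn F S p L) (hS : ∀ c : Circle, rot c p ∈ S)
    (hF : ∀ c : Circle, F (rot c p) = rot c (F p)) :
    L (Complex.I * p.1, 0) = (Complex.I * (F p).1, 0) := by
  obtain ⟨Γ, hΓ, hΓ1⟩ := hasMFDerivAt_rot (E := E) p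
  obtain ⟨Γ', hΓ', hΓ1'⟩ := hasMFDerivAt_rot (E := E') (F p)
  have h0 : rot (Circle.exp 0) p = p := by simp [rot]
  have hL' : HasMFDerivWithinAt (totalModel E) (totalModel E') F S (rot (Circle.exp 0) p) L := by
    rw [h0]; exact hL
  have h1 : HasMFDerivWithinAt 𝓘(ℝ, ℝ) (totalModel E') (F ∘ fun θ : ℝ => rot (Circle.exp θ) p)
      univ 0 (L.comp Γ) :=
    HasMFDerivWithinAt.comp 0 hL' hΓ.hasMFDerivWithinAt fun θ _ => hS _
  have h2 := (hasMFDerivWithinAt_univ.1 h1).congr_of_eventuallyEq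
    (f₁ := fun θ : ℝ => rot (Circle.exp θ) (F p)) (.of_forall fun θ => (hF _).symm)
  have h3 : L.comp Γ = Γ' := hasMFDerivAt_unique h2 hΓ'
  rw [← hΓ1, ← hΓ1', ← h3]
  rfl

end Rotation

/-! ### Conformal factor of a collar isomorphism -/

section Collar

variable {E : Type*} [NormedAddCommGroup E] [NormedSpace ℂ E] [FiniteDimensional ℂ E]
  {M : Type*} [TopologicalSpace M] [T2Space M] [ChartedSpace E M] [IsManifold 𝓘(ℂ, E) ω M]
  {E' : Type*} [NormedAddCommGroup E'] [NormedSpace ℂ E'] [FiniteDimensional ℂ E']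
  {M' : Type*} [TopologicalSpace M'] [T2Space M'] [ChartedSpace E' M'] [IsManifold 𝓘(ℂ, E') ω M']
  {φ : M → ℝ} {φ' : M' → ℝ}

/-- The conformal factor of a smooth contact map is smooth. -/
theorem contMDiffOn_conformal_factor (hφ : IsPseudoconvexDefining (E := E) φ)
    (hφ' : IsPseudoconvexDefining (E := E') φ') {O : Set (ℂ × M)} (hO : IsOpen O)
    {F : ℂ × M → ℂ × M'} (hF : IsSmoothOn (E := E) (E' := E') F (O ∩ ballBoundary φ))
    (hFX : MapsTo F (O ∩ ballBoundary φ) (ballBoundary φ')) {a : ℂ × M → ℝ}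
    (ha : ∀ p ∈ O ∩ ballBoundary φ, ∃ L : ℂ × E →L[ℝ] ℂ × E',
      HasDerivOn F (O ∩ ballBoundary φ) p L ∧ ∀ w, IsTangent φ p w →
        contactForm φ' (F p) (L w) = a p * contactForm φ p w) :
    ContMDiffOn (totalModel E) 𝓘(ℝ, ℝ) ∞ a (O ∩ ballBoundary φ) := by
  intro p hp
  obtain ⟨ι, _, W, hW⟩ := hφ.exists_primitive
  obtain ⟨ι', _, W', hW'⟩ := hφ'.exists_primitive
  obtain ⟨κ, K, y₀, hy₀, h1, h2, h3, h4, hK, hK'⟩ := hφ.exists_parametrization hp.2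
  obtain ⟨v, hvt, hv⟩ := hφ.exists_contactForm_ne_zero hp.2
  have hS : ∀ᶠ y in 𝓝 y₀, κ y ∈ O ∩ ballBoundary φ := by
    filter_upwards [h2, h1.continuousAt.eventually (hO.mem_nhds (by rw [h4]; exact hp.1))] with
      y hy hyO using ⟨hyO, hy.1⟩
  -- The factor is the quotient of the two contact forms on the image of a fixed vector `v`. Tangent
  -- spaces are read in a chart that varies with the point, so smoothness is not visible in
  -- `contactForm`; writing both forms through the primitives `W'` and `W` leaves derivatives of
  -- smooth functions of `y`.
  set num : ℂ × E → ℝ := fun y => ∑ k, (conj (W' k (F (κ y))) *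
    fderiv ℝ (fun z => W' k (F (κ z))) y v).im with hnum
  set den : ℂ × E → ℝ := fun y => ∑ k, (conj (W k (κ y)) *
    fderiv ℝ (fun z => W k (κ z)) y v).im with hden
  have hsm : ∀ {g : ℂ × E → ℂ}, ContDiffAt ℝ ∞ g y₀ →
      ContDiffAt ℝ ∞ (fun y => (conj (g y) * fderiv ℝ g y v).im) y₀ := fun {g} hg =>
    Complex.imCLM.contDiff.contDiffAt.comp y₀
      ((Complex.conjCLE.contDiff.contDiffAt.comp y₀ hg).mul
        ((hg.fderiv_right (m := ∞) (by simp)).clm_apply contDiffAt_const))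
  have hFκ : ContMDiffAt 𝓘(ℝ, ℂ × E) (totalModel E') ∞ (fun z => F (κ z)) y₀ := by
    have : ContMDiffWithinAt (totalModel E) (totalModel E') ∞ F (O ∩ ballBoundary φ) (κ y₀) := by
      rw [h4]; exact hF p hp
    exact (ContMDiffWithinAt.comp (g := F) (f := κ) (s := {y | κ y ∈ O ∩ ballBoundary φ}) y₀ this
      h1.contMDiffWithinAt fun y hy => hy).contMDiffAt hS
  have hnums : ContDiffAt ℝ ∞ num y₀ := ContDiffAt.sum fun k _ => hsm
    (contMDiffAt_iff_contDiffAt.1 (ContMDiffAt.comp y₀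
      (by rw [h4]; exact (hW' _ (hFX hp)).1 k) hFκ))
  have hdens : ContDiffAt ℝ ∞ den y₀ := ContDiffAt.sum fun k _ => hsm
    (contMDiffAt_iff_contDiffAt.1 (ContMDiffAt.comp y₀
      (by rw [h4]; exact (hW _ hp.2).1 k) h1))
  have hdenκ : ∀ y (L : ℂ × E →L[ℝ] ℂ × E), κ y ∈ ballBoundary φ →
      HasMFDerivAt 𝓘(ℝ, ℂ × E) (totalModel E) κ y L → den y = contactForm φ (κ y) (L v) := by
    intro y L hy hL
    obtain ⟨-, LW, hLW, hLW'⟩ := hW _ hy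
    rw [← hLW']
    refine Finset.sum_congr rfl fun k _ => ?_
    rw [(HasMFDerivWithinAt.hasFDerivAt_comp (hasMFDerivWithinAt_univ.2 (hLW k)) hL
      (by simp)).fderiv]
    rfl
  have hden0 : den y₀ ≠ 0 := by
    rw [hdenκ y₀ K (by rw [h4]; exact hp.2) hK, hK' v hvt, h4]
    exact hv
  have hval : ∀ᶠ y in 𝓝 y₀, a (κ y) = num y / den y := by
    filter_upwards [h2, eventually_eventually_nhds.2 hS,
      hdens.continuousAt.eventually_ne hden0] with y hy hyS hyd
    obtain ⟨L, hL, hLt⟩ := hy.2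
    obtain ⟨LF, hLF, hLF'⟩ := ha _ hyS.self_of_nhds
    obtain ⟨-, LW, hLW, hLW'⟩ := hW' _ (hFX hyS.self_of_nhds)
    rw [eq_div_iff hyd, hdenκ y L hy.1 hL, ← hLF' _ (hLt v), ← hLW']
    refine Finset.sum_congr rfl fun k _ => ?_
    have h5 : HasMFDerivWithinAt (totalModel E) 𝓘(ℝ, ℂ) (fun q => W' k (F q))
        (O ∩ ballBoundary φ) (κ y) ((LW k).comp LF) :=
      HasMFDerivAt.comp_hasMFDerivWithinAt (κ y) (hLW k) hLF
    rw [(HasMFDerivWithinAt.hasFDerivAt_comp h5 hL hyS).fderiv]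
    rfl
  have hquot : ContMDiffAt (totalModel E) 𝓘(ℝ, ℝ) ∞
      (fun q => num (extChartAt (totalModel E) p q) / den (extChartAt (totalModel E) p q)) p := by
    have : IsManifold 𝓘(ℝ, E) ∞ M := isManifold_real
    have h5 : ContDiffAt ℝ ∞ (fun y => num y / den y) (extChartAt (totalModel E) p p) := by
      rw [← hy₀]; exact hnums.div hdens hden0
    exact ContMDiffAt.comp p (g := fun y => num y / den y) h5.contMDiffAt contMDiffAt_extChartAt
  refine hquot.contMDiffWithinAt.congr_of_eventuallyEq_of_mem ?_ hp
  have hc : Filter.Tendsto (extChartAt (totalModel E) p) (𝓝 p) (𝓝 y₀) :=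
    hy₀ ▸ continuousAt_extChartAt p
  filter_upwards [self_mem_nhdsWithin, nhdsWithin_le_nhds h3,
    nhdsWithin_le_nhds (hc.eventually hval)] with q hqS hq hqv
  rw [← hqv, hq hqS.2]

/-- A collar isomorphism multiplies the coordinate `t` by a smooth positive function `r`, and the
form `dφ ∘ J` by `r²`. -/
theorem IsCollarIso.exists_factor (hφ : IsPseudoconvexDefining (E := E) φ)
    (hφ' : IsPseudoconvexDefining (E := E') φ') {f : PartialEquiv (ℂ × M) (ℂ × M')}
    (hf : IsCollarIso (E := E) (E' := E') φ φ' f) :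
    ∃ r : ℂ × M → ℝ, ContMDiffOn (totalModel E) 𝓘(ℝ, ℝ) ∞ r f.source ∧
      (∀ p ∈ f.source, 0 < r p) ∧ (∀ p ∈ f.source, (f p).1 = r p • p.1) ∧
      (∀ p ∈ f.source, ∀ c : Circle, r (rot c p) = r p) ∧
      ∀ p ∈ f.source, ∃ L : ℂ × E →L[ℝ] ℂ × E', HasDerivOn f f.source p L ∧
        ∀ w, IsTangent φ p w →
          diff φ' (f p).2 (Complex.I • (L w).2) = r p ^ 2 * diff φ p.2 (Complex.I • w.2) := by
  obtain ⟨O, hO, hs⟩ := hf.source_open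
  obtain ⟨O', hO', hs'⟩ := hf.target_open
  have hX : ∀ p ∈ f.source, p ∈ ballBoundary φ := fun p hp => by rw [hs] at hp; exact hp.2
  have hX' : ∀ p ∈ f.source, f p ∈ ballBoundary φ' := fun p hp => by
    have := f.map_source hp
    rw [hs'] at this; exact this.2
  have hcontact := hf.contact
  simp only [IsContactOn] at hcontact
  choose! L hL a ha0 ha using hcontact
  -- The contact form takes the value $|t|^2$ on the generator $(it,0)$, and `f` maps generator to
  -- generator.
  have hnorm : ∀ p ∈ f.source, p.1 ≠ 0 → ‖(f p).1‖ ^ 2 = a p * ‖p.1‖ ^ 2 := by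
    intro p hp _
    have h1 := HasDerivOn.map_rot (hL p hp) (fun c => hf.rot_mem c p hp)
      (fun c => hf.equivariant c p hp)
    obtain ⟨D, -, hD⟩ := exists_hasMFDerivAt_diff (hφ.smooth.mdifferentiable (by simp) p.2)
    obtain ⟨D', -, hD'⟩ := exists_hasMFDerivAt_diff (hφ'.smooth.mdifferentiable (by simp) (f p).2)
    have h2 : IsTangent φ p ((Complex.I * p.1, 0) : ℂ × E) := by
      simp only [IsTangent, hD, map_zero]
      simp
      ring
    have h3 := ha p hp _ h2
    rw [h1, contactForm_eq, contactForm_eq, hD, hD'] at h3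
    simp [mul_left_comm _ Complex.I, ← Complex.normSq_eq_conj_mul_self,
      Complex.normSq_eq_norm_sq] at h3
    exact_mod_cast h3
  -- The multiplier in `t_pos` is undetermined where $t=0$. The square root of the conformal factor
  -- agrees with it elsewhere and is smooth across $X_0$.
  have ht : ∀ p ∈ f.source, (f p).1 = √(a p) • p.1 := by
    intro p hp
    obtain ⟨s, hs0, hsp⟩ := hf.t_pos p hp
    by_cases h0 : p.1 = 0
    · simp [hsp, h0]
    · have h1 := hnorm p hp h0
      rw [hsp, norm_mul, mul_pow, Complex.norm_real, Real.norm_eq_abs, sq_abs] at h1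
      have h2 : s ^ 2 = a p := mul_right_cancel₀ (pow_ne_zero 2 (norm_ne_zero_iff.2 h0)) h1
      rw [hsp, ← h2, Real.sqrt_sq hs0.le, Complex.real_smul]
  have hsmooth : ContMDiffOn (totalModel E) 𝓘(ℝ, ℝ) ∞ a f.source := by
    have hsm := hf.smooth
    rw [hs] at hL ha hsm ⊢
    exact contMDiffOn_conformal_factor hφ hφ' hO hsm (fun p hp => hX' p (by rw [hs]; exact hp))
      fun p hp => ⟨L p, hL p hp, ha p hp⟩
  have hr : ContMDiffOn (totalModel E) 𝓘(ℝ, ℝ) ∞ (fun p => √(a p)) f.source := fun p hp =>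
    ContMDiffAt.comp_contMDiffWithinAt p (g := Real.sqrt)
      (Real.contDiffAt_sqrt (ha0 p hp).ne').contMDiffAt (hsmooth p hp)
  refine ⟨fun p => √(a p), hr, fun p hp => Real.sqrt_pos.2 (ha0 p hp), ht, fun p hp c => ?_,
    fun p hp => ⟨L p, hL p hp, fun w hw => ?_⟩⟩
  · by_cases h0 : p.1 = 0
    · have : rot c p = p := by ext <;> simp [rot, h0]
      rw [this]
    · have h1 := ht _ (hf.rot_mem c p hp)
      rw [hf.equivariant c p hp] at h1
      simp only [rot, ht p hp] at h1
      rw [mul_smul_comm] at h1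
      exact (smul_left_injective ℝ (mul_ne_zero (Circle.coe_ne_zero c) h0) h1).symm
  · obtain ⟨l, hl⟩ : ∃ l : ℂ × E →L[ℝ] ℝ,
        HasMFDerivWithinAt (totalModel E) 𝓘(ℝ, ℝ) (fun p => √(a p)) f.source p l :=
      ⟨_, ((hr p hp).mdifferentiableWithinAt (by simp)).hasMFDerivWithinAt⟩
    have h1 := HasMFDerivWithinAt.vector_smul (L := ContinuousLinearMap.fst ℝ ℂ E) hl
      (hasMFDerivWithinAt_fst (I := 𝓘(ℝ, ℂ)) (I' := 𝓘(ℝ, E)) (s := f.source) (x := p))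
    have h2 : HasMFDerivWithinAt (totalModel E) 𝓘(ℝ, ℂ) (fun q => (f q).1) f.source p
        ((ContinuousLinearMap.fst ℝ ℂ E').comp (L p)) :=
      HasMFDerivAt.comp_hasMFDerivWithinAt p
        (hasMFDerivAt_fst (I := 𝓘(ℝ, ℂ)) (I' := 𝓘(ℝ, E')) (f p)) (hL p hp)
    have h3 := h1.congr_of_eventuallyEq (f₁ := fun q => (f q).1)
      (by filter_upwards [self_mem_nhdsWithin] with q hq using ht q hq) (ht p hp)
    -- Both sides differentiate $t'\circ f=r\,t$ along a tangent vector. Hence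
    -- $\operatorname{Im}(\bar t'\,dt')$ pulls back to $r^2\operatorname{Im}(\bar t\,dt)$, and
    -- subtracting this from the contact condition leaves the claim on $d\phi\circ J$.
    have h4 : (L p w).1 = √(a p) • w.1 + l w • p.1 := by
      rw [hs] at h2 h3 hp
      exact hφ.deriv_unique hO hp h2 h3 hw
    have h5 := ha p hp w hw
    have h6 := Real.sq_sqrt (ha0 p hp).le
    rw [contactForm_eq, contactForm_eq, h4, ht p hp] at h5
    rw [im_conj_smul_mul, h6] at h5
    rw [h6]
    linarith

end Collar

/-! ### Cut-off functions near the binding -/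

section Plateau

/-- A function of `|t|²` that is `1` for `|t|² ≤ δ / 3` and `0` for `2 δ / 3 ≤ |t|²`. -/
def plateau {M : Type*} (δ : ℝ) (p : ℂ × M) : ℝ :=
  Real.cos (Real.pi / 2 * Real.smoothTransition (3 * ‖p.1‖ ^ 2 / δ - 1))

/-- The companion of `plateau`, with `plateau ^ 2 + coplateau ^ 2 = 1`. -/
def coplateau {M : Type*} (δ : ℝ) (p : ℂ × M) : ℝ :=
  Real.sin (Real.pi / 2 * Real.smoothTransition (3 * ‖p.1‖ ^ 2 / δ - 1))

section

variable {M : Type*} {δ : ℝ} {p : ℂ × M}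

theorem plateau_sq_add_coplateau_sq : plateau δ p ^ 2 + coplateau δ p ^ 2 = 1 :=
  Real.cos_sq_add_sin_sq _

theorem smoothTransition_eq_zero (hδ : 0 < δ) (h : ‖p.1‖ ^ 2 < δ / 3) :
    Real.smoothTransition (3 * ‖p.1‖ ^ 2 / δ - 1) = 0 := by
  refine Real.smoothTransition.zero_of_nonpos ?_
  rw [sub_nonpos, div_le_one hδ]
  linarith

theorem plateau_eq_one (hδ : 0 < δ) (h : ‖p.1‖ ^ 2 < δ / 3) : plateau δ p = 1 := by
  simp [plateau, smoothTransition_eq_zero hδ h]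

theorem coplateau_eq_zero (hδ : 0 < δ) (h : ‖p.1‖ ^ 2 < δ / 3) : coplateau δ p = 0 := by
  simp [coplateau, smoothTransition_eq_zero hδ h]

theorem plateau_eq_zero (hδ : 0 < δ) (h : 2 * δ / 3 < ‖p.1‖ ^ 2) : plateau δ p = 0 := by
  have : Real.smoothTransition (3 * ‖p.1‖ ^ 2 / δ - 1) = 1 := by
    refine Real.smoothTransition.one_of_one_le ?_
    rw [le_sub_iff_add_le, le_div_iff₀ hδ]
    linarith
  simp [plateau, this]

theorem norm_rot_fst (c : Circle) : ‖(rot c p).1‖ = ‖p.1‖ := by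
  rw [rot, norm_mul, Circle.norm_coe, one_mul]

theorem plateau_rot (c : Circle) : plateau δ (rot c p) = plateau δ p := by
  rw [plateau, norm_rot_fst, plateau]

theorem coplateau_rot (c : Circle) : coplateau δ (rot c p) = coplateau δ p := by
  rw [coplateau, norm_rot_fst, coplateau]

end

variable {E : Type*} [NormedAddCommGroup E] [NormedSpace ℂ E]
  {M : Type*} [TopologicalSpace M] [ChartedSpace E M] {φ : M → ℝ} {δ : ℝ}

theorem contDiff_transition :
    ContDiff ℝ ∞ fun z : ℂ => Real.pi / 2 * Real.smoothTransition (3 * ‖z‖ ^ 2 / δ - 1) :=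
  contDiff_const.mul (Real.smoothTransition.contDiff.comp
    (((contDiff_const.mul (contDiff_norm_sq ℝ)).div_const δ).sub contDiff_const))

theorem contMDiff_plateau : ContMDiff (totalModel E) 𝓘(ℝ, ℝ) ∞ (plateau (M := M) δ) :=
  ContMDiff.comp (g := fun z : ℂ => Real.cos (Real.pi / 2 *
    Real.smoothTransition (3 * ‖z‖ ^ 2 / δ - 1)))
    (Real.contDiff_cos.comp contDiff_transition).contMDiff contMDiff_fst

theorem contMDiff_coplateau : ContMDiff (totalModel E) 𝓘(ℝ, ℝ) ∞ (coplateau (M := M) δ) :=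
  ContMDiff.comp (g := fun z : ℂ => Real.sin (Real.pi / 2 *
    Real.smoothTransition (3 * ‖z‖ ^ 2 / δ - 1)))
    (Real.contDiff_sin.comp contDiff_transition).contMDiff contMDiff_fst

/-- Every neighbourhood of the binding contains a collar `{|t|² < δ}`. -/
theorem IsPseudoconvexDefining.exists_collar (hφ : IsPseudoconvexDefining (E := E) φ)
    {O : Set (ℂ × M)} (hO : IsOpen O) (hb : binding φ ⊆ O) :
    ∃ δ : ℝ, 0 < δ ∧ ∀ p ∈ ballBoundary φ, ‖p.1‖ ^ 2 < δ → p ∈ O := by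
  have hφc : Continuous φ := hφ.smooth.continuous
  have hclosed : IsClosed (ballBoundary φ) :=
    isClosed_eq (by fun_prop) (by fun_prop)
  obtain ⟨C, hC⟩ := hφ.isCompact_nonneg.bddAbove_image hφc.continuousOn
  have hcomp : IsCompact (ballBoundary φ) := by
    refine ((isCompact_closedBall (0 : ℂ) √C).prod hφ.isCompact_nonneg).of_isClosed_subset hclosed
      fun p hp => ⟨?_, nonneg_of_mem_ballBoundary hp⟩
    rw [mem_closedBall_zero_iff]
    refine Real.le_sqrt_of_sq_le ?_
    have : ‖p.1‖ ^ 2 = φ p.2 := hp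
    rw [this]
    exact hC ⟨p.2, nonneg_of_mem_ballBoundary hp, rfl⟩
  have hcomp' : IsCompact (ballBoundary φ \ O) := hcomp.diff hO
  rcases (ballBoundary φ \ O).eq_empty_or_nonempty with h0 | h0
  · exact ⟨1, one_pos, fun p hp _ => sdiff_eq_empty.1 h0 hp⟩
  -- The width is the minimum of $|t|^2$ on the compact set $X\setminus O$; it is positive because a
  -- point of $X$ with $t=0$ lies in the binding.
  · obtain ⟨q, hq, hmin⟩ := hcomp'.exists_isMinOn h0 (f := fun p => ‖p.1‖ ^ 2)
      (Continuous.continuousOn (by fun_prop))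
    refine ⟨‖q.1‖ ^ 2, ?_, fun p hp hlt => ?_⟩
    · refine pow_pos (norm_pos_iff.2 fun h => hq.2 (hb ⟨h, ?_⟩)) 2
      have : ‖q.1‖ ^ 2 = φ q.2 := hq.1
      simpa [h] using this.symm
    · by_contra hpO
      exact absurd (hmin ⟨hp, hpO⟩) (not_le.2 hlt)

/-- A piece `S` of `X` is open in `X` and contains the collar `{|t|² < δ}`. -/
structure IsCollarPiece (φ : M → ℝ) (δ : ℝ) (S : Set (ℂ × M)) : Prop where
  pos : 0 < δ
  isOpen : ∃ O : Set (ℂ × M), IsOpen O ∧ S = O ∩ ballBoundary φ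
  mem : ∀ p ∈ ballBoundary φ, ‖p.1‖ ^ 2 < δ → p ∈ S

namespace IsCollarPiece

variable {S : Set (ℂ × M)}

theorem mem_nhdsWithin (h : IsCollarPiece φ δ S) {p : ℂ × M} (hp : p ∈ S) :
    S ∈ 𝓝[ballBoundary φ] p := by
  obtain ⟨O, hO, rfl⟩ := h.isOpen
  exact Filter.inter_mem (mem_nhdsWithin_of_mem_nhds (hO.mem_nhds hp.1)) self_mem_nhdsWithin

/-- A function meaningful only on the piece `S` can be multiplied by `plateau` and treated on all of
$X$: at a point outside `S` the product vanishes on a neighbourhood. -/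
theorem mem_or_eventually (h : IsCollarPiece φ δ S) {p : ℂ × M} (hp : p ∈ ballBoundary φ) :
    p ∈ S ∨ ∀ᶠ q in 𝓝 p, plateau δ q = 0 := by
  refine or_iff_not_imp_left.2 fun hpS => ?_
  have h1 : 2 * δ / 3 < ‖p.1‖ ^ 2 := by
    have := not_lt.1 fun hlt => hpS (h.mem p hp hlt)
    linarith [h.pos]
  have h2 : Continuous fun q : ℂ × M => ‖q.1‖ ^ 2 := by fun_prop
  filter_upwards [h2.continuousAt.eventually (lt_mem_nhds h1)] with q hq
  exact plateau_eq_zero h.pos hq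

theorem contMDiffOn_plateau_smul (h : IsCollarPiece φ δ S) {V : Type*} [NormedAddCommGroup V]
    [NormedSpace ℝ V] {u : ℂ × M → V} (hu : ContMDiffOn (totalModel E) 𝓘(ℝ, V) ∞ u S) :
    ContMDiffOn (totalModel E) 𝓘(ℝ, V) ∞ (fun p => plateau δ p • u p) (ballBoundary φ) := by
  intro p hp
  rcases h.mem_or_eventually hp with hpS | h0
  · exact contMDiff_plateau.contMDiffAt.contMDiffWithinAt.smul
      ((hu p hpS).mono_of_mem_nhdsWithin (h.mem_nhdsWithin hpS))
  · refine (contMDiffWithinAt_const (c := (0 : V))).congr_of_eventuallyEq_of_mem ?_ hp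
    filter_upwards [nhdsWithin_le_nhds h0] with q hq
    rw [hq, zero_smul]

theorem plateau_smul_rot (h : IsCollarPiece φ δ S) {V : Type*} [AddCommGroup V] [Module ℝ V]
    {u : ℂ × M → V} (hu : ∀ p ∈ S, ∀ c : Circle, u (rot c p) = u p) {p : ℂ × M}
    (hp : p ∈ ballBoundary φ) (c : Circle) :
    plateau δ (rot c p) • u (rot c p) = plateau δ p • u p := by
  rw [plateau_rot]
  rcases h.mem_or_eventually hp with hpS | h0
  · rw [hu p hpS]
  · rw [h0.self_of_nhds, zero_smul, zero_smul]

end IsCollarPiece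

end Plateau

/-! ### Assembling tuples from primitives and real functions -/

section Parts

variable {E : Type*} [NormedAddCommGroup E] [NormedSpace ℂ E]
  {M : Type*} [TopologicalSpace M] [ChartedSpace E M] {φ : M → ℝ}

/-- A finite family of invariant complex functions on `X` with `∑ Im (v̄ dv) = b · ½ dφ ∘ J`. -/
structure IsInvariantPrimitive (φ : M → ℝ) (b : ℂ × M → ℝ) {ι : Type*} [Fintype ι]
    (v : ι → ℂ × M → ℂ) : Prop where
  smooth : ∀ k, ContMDiffOn (totalModel E) 𝓘(ℝ, ℂ) ∞ (v k) (ballBoundary φ)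
  invariant : ∀ k, ∀ c : Circle, ∀ p ∈ ballBoundary φ, v k (rot c p) = v k p
  deriv : ∀ p ∈ ballBoundary φ, ∃ L : ι → ℂ × E →L[ℝ] ℂ,
    (∀ k, HasMFDerivWithinAt (totalModel E) 𝓘(ℝ, ℂ) (v k) (ballBoundary φ) p (L k)) ∧
    ∀ w, IsTangent φ p w →
      ∑ k, (conj (v k p) * L k w).im = b p * (diff φ p.2 (Complex.I • w.2) / 2)

namespace IsInvariantPrimitive

theorem zero {ι : Type*} [Fintype ι] :
    IsInvariantPrimitive (E := E) φ (fun _ => 0) fun (_ : ι) _ => 0 :=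
  ⟨fun _ => contMDiffOn_const, fun _ _ _ _ => rfl, fun p _ =>
    ⟨fun _ => 0, fun _ => hasMFDerivWithinAt_const _ _ _, fun w _ => by simp⟩⟩

theorem sum {b b' : ℂ × M → ℝ} {ι ι' : Type*} [Fintype ι] [Fintype ι'] {v : ι → ℂ × M → ℂ}
    {v' : ι' → ℂ × M → ℂ} (hv : IsInvariantPrimitive (E := E) φ b v)
    (hv' : IsInvariantPrimitive (E := E) φ b' v') :
    IsInvariantPrimitive (E := E) φ (fun p => b p + b' p) (Sum.elim v v') := by
  refine ⟨?_, ?_, fun p hp => ?_⟩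
  · rintro (i | i)
    exacts [hv.smooth i, hv'.smooth i]
  · rintro (i | i)
    exacts [hv.invariant i, hv'.invariant i]
  · obtain ⟨L, hL, hc⟩ := hv.deriv p hp
    obtain ⟨L', hL', hc'⟩ := hv'.deriv p hp
    refine ⟨Sum.elim L L', ?_, fun w hw => ?_⟩
    · rintro (i | i)
      exacts [hL i, hL' i]
    · rw [Fintype.sum_sum_type, add_mul, ← hc w hw, ← hc' w hw]
      rfl

/-- A primitive on the base, multiplied by an invariant function. -/
theorem smul_snd {ι : Type*} [Fintype ι] {u : ι → M → ℂ}
    (hu : ∀ i, ∀ x ∈ {x | 0 ≤ φ x}, ContMDiffAt 𝓘(ℝ, E) 𝓘(ℝ, ℂ) ∞ (u i) x)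
    (hβ : ∀ x ∈ {x | 0 ≤ φ x}, ∀ v : E,
      ∑ i, (conj (u i x) * cdiff (u i) x v).im = diff φ x (Complex.I • v) / 2)
    {s : ℂ × M → ℝ} (hs : ContMDiff (totalModel E) 𝓘(ℝ, ℝ) ∞ s)
    (hsr : ∀ (c : Circle) p, s (rot c p) = s p) :
    IsInvariantPrimitive (E := E) φ (fun p => s p ^ 2) fun i p => s p • u i p.2 := by
  refine ⟨fun i p hp => ?_, fun i c p _ => by rw [hsr]; rfl, fun p hp => ?_⟩
  · exact (hs.contMDiffAt.smul (ContMDiffAt.comp p (hu i _ (nonneg_of_mem_ballBoundary hp))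
      contMDiffAt_snd)).contMDiffWithinAt
  · have h1 := fun i => exists_hasMFDerivAt_cdiff
      ((hu i p.2 (nonneg_of_mem_ballBoundary hp)).mdifferentiableAt (by simp))
    choose L hL hL' using h1
    obtain ⟨l, hl⟩ : ∃ l : ℂ × E →L[ℝ] ℝ,
        HasMFDerivWithinAt (totalModel E) 𝓘(ℝ, ℝ) s (ballBoundary φ) p l :=
      ⟨_, (hs.mdifferentiable (by simp) p).hasMFDerivAt.hasMFDerivWithinAt⟩
    have h2 : ∀ i, HasMFDerivWithinAt (totalModel E) 𝓘(ℝ, ℂ) (fun q => u i q.2)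
        (ballBoundary φ) p ((L i).comp (ContinuousLinearMap.snd ℝ ℂ E)) := fun i =>
      ((hasMFDerivWithinAt_univ.1 (hL i)).comp p
        (hasMFDerivAt_snd (I := 𝓘(ℝ, ℂ)) (I' := 𝓘(ℝ, E)) p)).hasMFDerivWithinAt
    refine ⟨fun i => _, fun i => HasMFDerivWithinAt.vector_smul hl (h2 i), fun w _ => ?_⟩
    rw [← hβ _ (nonneg_of_mem_ballBoundary hp), Finset.mul_sum]
    refine Finset.sum_congr rfl fun i _ => ?_
    rw [hL']
    exact im_conj_smul_mul (s p) (l w) (u i p.2) (L i w.2)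

end IsInvariantPrimitive

/-- Real functions do not contribute to `∑ Im (v̄ dv)`, so they can be used to embed. -/
theorem IsEmbeddingTuple.of_parts {ι κ κ' : Type*} [Fintype ι] [Fintype κ] [Fintype κ']
    {v : ι → ℂ × M → ℂ} (hv : IsInvariantPrimitive (E := E) φ (fun _ => 1) v) {g : κ → M → ℝ}
    (hg : ∀ k, ContMDiff 𝓘(ℝ, E) 𝓘(ℝ, ℝ) ∞ (g k)) (hg1 : ∃ k, ∀ x, g k x = 1)
    (hginj : ∀ x ∈ {x | 0 ≤ φ x}, ∀ y ∈ {x | 0 ≤ φ x}, (∀ k, g k x = g k y) → x = y)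
    (hgimm : ∀ x ∈ {x | 0 ≤ φ x}, ∀ v : E, (∀ k, diff (g k) x v = 0) → v = 0)
    {ρ : κ' → ℂ × M → ℝ}
    (hρ : ∀ k, ContMDiffOn (totalModel E) 𝓘(ℝ, ℝ) ∞ (ρ k) (ballBoundary φ))
    (hρr : ∀ k, ∀ c : Circle, ∀ p ∈ ballBoundary φ, ρ k (rot c p) = ρ k p) :
    IsEmbeddingTuple (E := E) φ (Sum.elim v (Sum.elim (fun k p => Complex.ofRealCLM (g k p.2))
      fun k p => Complex.ofRealCLM (ρ k p))) := by
  refine ⟨?_, ?_, fun p hp q hq s h => ?_, fun p hp => ?_⟩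
  · rintro (i | k | k)
    · exact hv.smooth i
    · exact (Complex.ofRealCLM.contDiff.contMDiff.comp
        ((hg k).comp contMDiff_snd)).contMDiffOn
    · exact Complex.ofRealCLM.contDiff.contMDiff.comp_contMDiffOn (hρ k)
  · rintro (i | k | k) c p hp
    · exact hv.invariant i c p hp
    · rfl
    · exact congrArg Complex.ofRealCLM (hρr k c p hp)
  · obtain ⟨k₀, hk₀⟩ := hg1
    have h1 : ∀ k, g k p.2 = s * g k q.2 := fun k => by
      have := h (Sum.inr (Sum.inl k))
      simp only [Sum.elim_inr, Sum.elim_inl, Complex.ofRealCLM_apply, Complex.real_smul] at this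
      exact_mod_cast this
    -- The constant component pins down the scaling.
    have hs : s = 1 := by simpa [hk₀] using (h1 k₀).symm
    refine ⟨hs, hginj _ (nonneg_of_mem_ballBoundary hp) _ (nonneg_of_mem_ballBoundary hq)
      fun k => ?_⟩
    rw [h1, hs, one_mul]
  · obtain ⟨L, hL, hc⟩ := hv.deriv p hp
    choose D hD hD' using fun k => exists_hasMFDerivAt_diff ((hg k).mdifferentiable (by simp) p.2)
    have h1 : ∀ k, HasMFDerivWithinAt (totalModel E) 𝓘(ℝ, ℝ) (fun q => g k q.2)
        (ballBoundary φ) p ((D k).comp (ContinuousLinearMap.snd ℝ ℂ E)) := fun k =>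
      ((hasMFDerivWithinAt_univ.1 (hD k)).comp p
        (hasMFDerivAt_snd (I := 𝓘(ℝ, ℂ)) (I' := 𝓘(ℝ, E)) p)).hasMFDerivWithinAt
    have h2 : ∀ k, ∃ l : ℂ × E →L[ℝ] ℝ,
        HasMFDerivWithinAt (totalModel E) 𝓘(ℝ, ℝ) (ρ k) (ballBoundary φ) p l := fun k =>
      ⟨_, ((hρ k p hp).mdifferentiableWithinAt (by simp)).hasMFDerivWithinAt⟩
    choose R hR using h2
    refine ⟨Sum.elim L (Sum.elim
      (fun k => Complex.ofRealCLM.comp ((D k).comp (ContinuousLinearMap.snd ℝ ℂ E)))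
      fun k => Complex.ofRealCLM.comp (R k)), ?_, fun w hw => ?_, fun w s h => ?_⟩
    · rintro (i | k | k)
      · exact hL i
      · exact HasMFDerivWithinAt.vector_clm_comp Complex.ofRealCLM (h1 k)
      · exact HasMFDerivWithinAt.vector_clm_comp Complex.ofRealCLM (hR k)
    · have h3 := hc w hw
      rw [one_mul] at h3
      rw [← h3]
      simp
    · obtain ⟨k₀, hk₀⟩ := hg1
      have h3 : ∀ k, D k w.2 = s * g k p.2 := fun k => by
        have := h (Sum.inr (Sum.inl k))
        simp only [Sum.elim_inr, Sum.elim_inl, Complex.ofRealCLM_apply, Complex.real_smul,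
          ContinuousLinearMap.comp_apply, ContinuousLinearMap.coe_snd'] at this
        exact_mod_cast this
      -- The constant component again: its derivative vanishes while its value is $1$, so `s` must
      -- be $0$.
      have h4 : D k₀ w.2 = 0 := by
        rw [← hD']
        refine diff_eq (L := (0 : E →L[ℝ] ℝ)) ?_ w.2
        rw [show g k₀ = fun _ => 1 from funext hk₀]
        exact hasMFDerivWithinAt_const _ _ _
      have hs : s = 0 := by simpa [hk₀, h4] using (h3 k₀).symm
      refine ⟨hs, hgimm _ (nonneg_of_mem_ballBoundary hp) _ fun k => ?_⟩
      rw [hD', h3, hs, zero_mul]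

end Parts

/-- `sphereMap` only depends on the ray of `(t, v)`. -/
theorem sphereMap_eq_of_smul {M M' : Type*} {N : ℕ} {v : Fin N → ℂ × M → ℂ}
    {v' : Fin N → ℂ × M' → ℂ} {p : ℂ × M} {p' : ℂ × M'} {r : ℝ} (hr : 0 < r)
    (h1 : p'.1 = r • p.1) (hv : ∀ k, v' k p' = r • v k p) : sphereMap v p = sphereMap v' p' := by
  have h : scaleFactor v' p' = r⁻¹ * scaleFactor v p := by
    simp only [scaleFactor, h1, hv, norm_smul, mul_pow]
    rw [← Finset.mul_sum, ← mul_add, Real.sqrt_mul (by positivity),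
      Real.sqrt_sq (norm_nonneg r), Real.norm_of_nonneg hr.le, mul_inv]
  have h2 : ∀ z : ℂ, scaleFactor v' p' • r • z = scaleFactor v p • z := fun z => by
    rw [h, smul_smul]
    congr 1
    field_simp
  simp only [sphereMap, h1, hv, h2]

/-! ### Transport of primitives along a collar map -/

section Collar

variable {E : Type*} [NormedAddCommGroup E] [NormedSpace ℂ E]
  {M : Type*} [TopologicalSpace M] [ChartedSpace E M]
  {E' : Type*} [NormedAddCommGroup E'] [NormedSpace ℂ E']
  {M' : Type*} [TopologicalSpace M'] [ChartedSpace E' M']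
  {φ : M → ℝ} {φ' : M' → ℝ}

theorem contMDiffOn_comp_snd {V : Type*} [NormedAddCommGroup V] [NormedSpace ℝ V]
    {S : Set (ℂ × M)} {F : ℂ × M → ℂ × M'} (hF : IsSmoothOn (E := E) (E' := E') F S)
    (hFX : MapsTo F S (ballBoundary φ')) {u : M' → V}
    (hu : ∀ x ∈ {x | 0 ≤ φ' x}, ContMDiffAt 𝓘(ℝ, E') 𝓘(ℝ, V) ∞ u x) :
    ContMDiffOn (totalModel E) 𝓘(ℝ, V) ∞ (fun p => u (F p).2) S := fun p hp =>
  ContMDiffAt.comp_contMDiffWithinAt p (g := fun q : ℂ × M' => u q.2)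
    (ContMDiffAt.comp (F p) (hu _ (nonneg_of_mem_ballBoundary (hFX hp))) contMDiffAt_snd) (hF p hp)

/-- A primitive on the base of the target of a collar map, pulled back and cut off. -/
theorem IsInvariantPrimitive.plateau_smul_comp {δ : ℝ} {S : Set (ℂ × M)}
    (hS : IsCollarPiece φ δ S) {F : ℂ × M → ℂ × M'}
    (hF : IsSmoothOn (E := E) (E' := E') F S) (hFX : MapsTo F S (ballBoundary φ'))
    (hFr : ∀ c : Circle, ∀ p ∈ S, F (rot c p) = rot c (F p)) {r : ℂ × M → ℝ}
    (hr : ContMDiffOn (totalModel E) 𝓘(ℝ, ℝ) ∞ r S) (hr0 : ∀ p ∈ S, 0 < r p)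
    (hrr : ∀ p ∈ S, ∀ c : Circle, r (rot c p) = r p)
    (hL : ∀ p ∈ S, ∃ L : ℂ × E →L[ℝ] ℂ × E', HasDerivOn F S p L ∧
      ∀ w, IsTangent φ p w →
        diff φ' (F p).2 (Complex.I • (L w).2) = r p ^ 2 * diff φ p.2 (Complex.I • w.2))
    {ι : Type*} [Fintype ι] {u : ι → M' → ℂ}
    (hu : ∀ i, ∀ x ∈ {x | 0 ≤ φ' x}, ContMDiffAt 𝓘(ℝ, E') 𝓘(ℝ, ℂ) ∞ (u i) x)
    (hβ : ∀ x ∈ {x | 0 ≤ φ' x}, ∀ v : E',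
      ∑ i, (conj (u i x) * cdiff (u i) x v).im = diff φ' x (Complex.I • v) / 2) :
    IsInvariantPrimitive (E := E) φ (fun p => plateau δ p ^ 2)
      fun i p => plateau δ p • (r p)⁻¹ • u i (F p).2 := by
  have hri : ContMDiffOn (totalModel E) 𝓘(ℝ, ℝ) ∞ (fun p => (r p)⁻¹) S := fun p hp =>
    ContMDiffAt.comp_contMDiffWithinAt p (g := fun s : ℝ => s⁻¹)
      (contDiffAt_inv ℝ (hr0 p hp).ne').contMDiffAt (hr p hp)
  refine ⟨fun i => hS.contMDiffOn_plateau_smul (hri.smul (contMDiffOn_comp_snd hF hFX (hu i))),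
    fun i c p hp => hS.plateau_smul_rot (u := fun p => (r p)⁻¹ • u i (F p).2)
      (fun q hq c => ?_) hp c, fun p hp => ?_⟩
  · simp only [hrr q hq, hFr c q hq]
    rfl
  · rcases hS.mem_or_eventually hp with hpS | h0
    · obtain ⟨L, hL, hLφ⟩ := hL p hpS
      have hpX := nonneg_of_mem_ballBoundary (hFX hpS)
      choose D hD hD' using fun i =>
        exists_hasMFDerivAt_cdiff ((hu i _ hpX).mdifferentiableAt (by simp))
      obtain ⟨l, hl⟩ : ∃ l : ℂ × E →L[ℝ] ℝ,
          HasMFDerivWithinAt (totalModel E) 𝓘(ℝ, ℝ) (fun p => (r p)⁻¹) S p l :=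
        ⟨_, ((hri p hpS).mdifferentiableWithinAt (by simp)).hasMFDerivWithinAt⟩
      obtain ⟨l', hl'⟩ : ∃ l : ℂ × E →L[ℝ] ℝ,
          HasMFDerivWithinAt (totalModel E) 𝓘(ℝ, ℝ) (plateau δ) (ballBoundary φ) p l :=
        ⟨_, (contMDiff_plateau.mdifferentiable (n := ∞) (by simp)
          p).hasMFDerivAt.hasMFDerivWithinAt⟩
      have h1 : ∀ i, HasMFDerivWithinAt (totalModel E) 𝓘(ℝ, ℂ) (fun q => u i (F q).2) S p
          (((D i).comp (ContinuousLinearMap.snd ℝ ℂ E')).comp L) := fun i =>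
        HasMFDerivAt.comp_hasMFDerivWithinAt (f := F) (g := fun q : ℂ × M' => u i q.2) p
          ((hasMFDerivWithinAt_univ.1 (hD i)).comp (F p)
            (hasMFDerivAt_snd (I := 𝓘(ℝ, ℂ)) (I' := 𝓘(ℝ, E')) (F p))) hL
      have h2 := fun i => (HasMFDerivWithinAt.vector_smul hl (h1 i)).mono_of_mem_nhdsWithin
        (hS.mem_nhdsWithin hpS)
      refine ⟨fun i => _, fun i => HasMFDerivWithinAt.vector_smul hl' (h2 i), fun w hw => ?_⟩
      -- The square of the factor $r^{-1}$ cancels the $r^2$ by which the map multiplies $d\phi\circ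
      -- J$.
      have h3 : diff φ p.2 (Complex.I • w.2) / 2 =
          (r p)⁻¹ ^ 2 * (diff φ' (F p).2 (Complex.I • (L w).2) / 2) := by
        rw [hLφ w hw]
        have := (hr0 p hpS).ne'
        field_simp
      rw [h3, ← hβ _ hpX, Finset.mul_sum, Finset.mul_sum]
      refine Finset.sum_congr rfl fun i _ => ?_
      rw [hD', ← im_conj_smul_mul _ (l w), ← im_conj_smul_mul _ (l' w)]
      rfl
    · refine ⟨fun i => 0, fun i => ?_, fun w _ => by simp [h0.self_of_nhds]⟩
      refine (hasMFDerivWithinAt_const (0 : ℂ) _ _).congr_of_eventuallyEq ?_ ?_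
      · filter_upwards [nhdsWithin_le_nhds h0] with q hq
        rw [hq, zero_smul]
      · rw [h0.self_of_nhds, zero_smul]

end Collar

end CircleBall

end

/-! ### Matching the two embeddings along the collar -/

open CircleBall in
theorem mainTheorem6
    {E : Type*} [NormedAddCommGroup E] [NormedSpace ℂ E] [FiniteDimensional ℂ E]
    {M : Type*} [TopologicalSpace M] [T2Space M] [ChartedSpace E M] [IsManifold 𝓘(ℂ, E) ω M]
    {E' : Type*} [NormedAddCommGroup E'] [NormedSpace ℂ E'] [FiniteDimensional ℂ E']
    {M' : Type*} [TopologicalSpace M'] [T2Space M'] [ChartedSpace E' M']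
    [IsManifold 𝓘(ℂ, E') ω M']
    (φ : M → ℝ) (hφ : CircleBall.IsPseudoconvexDefining (E := E) φ)
    (φ' : M' → ℝ) (hφ' : CircleBall.IsPseudoconvexDefining (E := E') φ')
    (f : PartialEquiv (ℂ × M) (ℂ × M'))
    (hf : CircleBall.IsCollarIso (E := E) (E' := E') φ φ' f) :
    ∃ N₀ : ℕ, ∀ N : ℕ, N₀ ≤ N →
      ∃ (U : ℂ × M → ℂ × EuclideanSpace ℂ (Fin N)) (U' : ℂ × M' → ℂ × EuclideanSpace ℂ (Fin N)),
        CircleBall.IsContactEmbedding (E := E) φ U ∧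
        CircleBall.IsContactEmbedding (E := E') φ' U' ∧
        (∃ W : Set (ℂ × M), IsOpen W ∧ CircleBall.binding φ ⊆ W ∧
          ∀ p ∈ W ∩ CircleBall.ballBoundary φ, p ∈ f.source ∧ U p = U' (f p)) ∧
        CircleBall.PullsBackCoordinate (E := E) φ U ∧
        CircleBall.PullsBackCoordinate (E := E') φ' U' := by
  obtain ⟨r, hr, hr0, hrt, hrr, hL⟩ := hf.exists_factor hφ hφ'
  obtain ⟨O, hO, hs⟩ := hf.source_open
  obtain ⟨O', hO', hs'⟩ := hf.target_open
  have hsX : f.source ⊆ ballBoundary φ := hs ▸ inter_subset_right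
  have hsX' : f.target ⊆ ballBoundary φ' := hs' ▸ inter_subset_right
  have hfX : MapsTo f f.source (ballBoundary φ') := fun p hp => hsX' (f.map_source hp)
  have hfX' : MapsTo f.symm f.target (ballBoundary φ) := fun p hp => hsX (f.map_target hp)
  obtain ⟨δ, hS⟩ : ∃ δ, IsCollarPiece φ δ f.source := by
    obtain ⟨δ, hδ, hδO⟩ := hφ.exists_collar hO
      (fun p hp => (hs ▸ hf.binding_subset hp : p ∈ O ∩ ballBoundary φ).1)
    exact ⟨δ, hδ, ⟨O, hO, hs⟩, fun p hp h => hs ▸ ⟨hδO p hp h, hp⟩⟩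
  obtain ⟨δ', hS'⟩ : ∃ δ, IsCollarPiece φ' δ f.target := by
    have hb : binding φ' ⊆ f.target := by
      rw [← hf.image_binding]
      rintro _ ⟨p, hp, rfl⟩
      exact f.map_source (hf.binding_subset hp)
    obtain ⟨δ, hδ, hδO⟩ := hφ'.exists_collar hO'
      (fun p hp => (hs' ▸ hb hp : p ∈ O' ∩ ballBoundary φ').1)
    exact ⟨δ, hδ, ⟨O', hO', hs'⟩, fun p hp h => hs' ▸ ⟨hδO p hp h, hp⟩⟩
  obtain ⟨ι, _, u, hu, hβ⟩ := isRepresentable_diff_I hφ.smooth hφ.isCompact_nonneg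
  obtain ⟨ι', _, u', hu', hβ'⟩ := isRepresentable_diff_I hφ'.smooth hφ'.isCompact_nonneg
  obtain ⟨κ, _, g, hg, hg1, hginj, hgimm⟩ := exists_real_embedding (E := E) hφ.isCompact_nonneg
  obtain ⟨κ', _, g', hg', hg1', hginj', hgimm'⟩ :=
    exists_real_embedding (E := E') hφ'.isCompact_nonneg
  have hri : ContMDiffOn (totalModel E) 𝓘(ℝ, ℝ) ∞ (fun p => (r p)⁻¹) f.source := fun p hp =>
    ContMDiffAt.comp_contMDiffWithinAt p (g := fun s : ℝ => s⁻¹)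
      (contDiffAt_inv ℝ (hr0 p hp).ne').contMDiffAt (hr p hp)
  have hrot' : ∀ p ∈ f.target, ∀ c : Circle, f.symm (rot c p) = rot c (f.symm p) := by
    intro p hp c
    have h1 := hf.equivariant c _ (f.map_target hp)
    rw [f.right_inv hp] at h1
    rw [← h1, f.left_inv (hf.rot_mem c _ (f.map_target hp))]
  -- On $X$ the transported primitive of $X'$ is used near $X_0$ and the primitive of $X$ away from
  -- it, with squared weights adding to $1$.
  have hprim : IsInvariantPrimitive (E := E) φ (fun _ => 1)
      (Sum.elim (fun i p => plateau δ p • (r p)⁻¹ • u' i (f p).2)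
        fun i p => coplateau δ p • u i p.2) := by
    have h1 := (IsInvariantPrimitive.plateau_smul_comp hS hf.smooth hfX hf.equivariant hr hr0 hrr hL
      hu' hβ').sum (IsInvariantPrimitive.smul_snd hu hβ (contMDiff_coplateau (δ := δ))
        fun c p => coplateau_rot c)
    simpa only [plateau_sq_add_coplateau_sq] using h1
  -- On $X'$ the primitive needs no cut-off. The block of zeros matches the components of $X$ that
  -- `coplateau` kills near $X_0$.
  have hprim' : IsInvariantPrimitive (E := E') φ' (fun _ => 1)
      (Sum.elim (fun i p => (1 : ℝ) • u' i p.2) fun (_ : ι) _ => 0) := by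
    have h1 := (IsInvariantPrimitive.smul_snd hu' hβ' (s := fun _ => 1) contMDiff_const
      fun c p => rfl).sum (IsInvariantPrimitive.zero (ι := ι))
    simpa only [one_pow, add_zero] using h1
  -- The extra real components copy those of the other side, scaled by $r^{-1}$ here and by $r$ in
  -- `hV'`, so that near $X_0$ the whole tuples differ by the single factor $r$.
  have hV := IsEmbeddingTuple.of_parts hprim hg hg1 hginj hgimm
    (ρ := fun (k : κ') p => plateau δ p • ((r p)⁻¹ • g' k (f p).2))
    (fun k => hS.contMDiffOn_plateau_smul (hri.smul
      (contMDiffOn_comp_snd hf.smooth hfX fun x _ => (hg' k).contMDiffAt)))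
    (fun k c p hp => hS.plateau_smul_rot (u := fun p => (r p)⁻¹ • g' k (f p).2)
      (fun q hq c => by simp only [hrr q hq, hf.equivariant c q hq]; rfl) hp c)
  have hV' := IsEmbeddingTuple.of_parts hprim' hg' hg1' hginj' hgimm'
    (ρ := fun (k : κ) p => plateau δ' p • (r (f.symm p) • g k (f.symm p).2))
    (fun k => hS'.contMDiffOn_plateau_smul
      ((hr.comp hf.smooth_symm fun p hp => f.map_target hp).smul
        (contMDiffOn_comp_snd hf.smooth_symm hfX' fun x _ => (hg k).contMDiffAt)))
    (fun k c p hp => hS'.plateau_smul_rot (u := fun p => r (f.symm p) • g k (f.symm p).2)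
      (fun q hq c => by
        simp only [hrot' q hq, hrr _ (f.map_target hq)]; rfl) hp c)
  refine ⟨Fintype.card ((ι' ⊕ ι) ⊕ (κ ⊕ κ')), fun N hN => ?_⟩
  obtain ⟨e⟩ : Nonempty (((ι' ⊕ ι) ⊕ (κ ⊕ κ')) ↪ Fin N) :=
    Function.Embedding.nonempty_of_card_le (by simpa using hN)
  -- Each side lists its own real components first, so one side swaps the two blocks to align the
  -- coordinates of the sphere.
  set e' : ((ι' ⊕ ι) ⊕ (κ' ⊕ κ)) ↪ Fin N :=
    ((Equiv.sumCongr (Equiv.refl _) (Equiv.sumComm κ' κ)).toEmbedding).trans e with he'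
  have hW := hV.extend e
  have hW' := hV'.extend e'
  refine ⟨_, _, hW.isContactEmbedding, hW'.isContactEmbedding, ?_, hW.pullsBackCoordinate,
    hW'.pullsBackCoordinate⟩
  have hcont : ContinuousOn f f.source := hf.smooth.continuousOn
  -- Agreement needs both cut-offs to be $1$: at $p$ for `δ` and at $f(p)$ for `δ'`.
  obtain ⟨O₂, hO₂, hO₂'⟩ := continuousOn_iff'.1 hcont {q | ‖q.1‖ ^ 2 < δ' / 3}
    (isOpen_lt (by fun_prop) (by fun_prop))
  have hδ := hS.pos
  have hδ' := hS'.pos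
  refine ⟨O₂ ∩ {p | ‖p.1‖ ^ 2 < δ / 3}, hO₂.inter (isOpen_lt (by fun_prop) (by fun_prop)),
    fun p hp => ⟨?_, ?_⟩, ?_⟩
  · have hps := hf.binding_subset hp
    have h1 : p ∈ f ⁻¹' {q | ‖q.1‖ ^ 2 < δ' / 3} ∩ f.source := by
      refine ⟨?_, hps⟩
      simp only [mem_preimage, mem_ofPred_eq, hrt p hps, hp.1, smul_zero, norm_zero]
      simpa using hδ'
    rw [hO₂'] at h1
    exact h1.1
  · simp only [mem_ofPred_eq, hp.1, norm_zero]
    simpa using hδ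
  · rintro p ⟨⟨hpO, hpδ⟩, hpX⟩
    have hpδ : ‖p.1‖ ^ 2 < δ / 3 := hpδ
    have hps : p ∈ f.source := hS.mem p hpX (by linarith)
    have hfp : ‖(f p).1‖ ^ 2 < δ' / 3 := by
      have : p ∈ f ⁻¹' {q | ‖q.1‖ ^ 2 < δ' / 3} ∩ f.source := hO₂' ▸ ⟨hpO, hps⟩
      exact this.1
    have hrp := (hr0 p hps).ne'
    refine ⟨hps, sphereMap_eq_of_smul (hr0 p hps) (hrt p hps) fun j => ?_⟩
    by_cases hj : ∃ k, e k = j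
    · obtain ⟨k, rfl⟩ := hj
      rw [e.injective.extend_apply]
      rcases k with (i | i) | k | k
      · rw [show e (Sum.inl (Sum.inl i)) = e' (Sum.inl (Sum.inl i)) from rfl,
          e'.injective.extend_apply]
        simp [plateau_eq_one hδ hpδ, hrp]
      · rw [show e (Sum.inl (Sum.inr i)) = e' (Sum.inl (Sum.inr i)) from rfl,
          e'.injective.extend_apply]
        simp [coplateau_eq_zero hδ hpδ]
      · rw [show e (Sum.inr (Sum.inl k)) = e' (Sum.inr (Sum.inr k)) from rfl,
          e'.injective.extend_apply]
        simp [plateau_eq_one hδ' hfp, f.left_inv hps]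
      · rw [show e (Sum.inr (Sum.inr k)) = e' (Sum.inr (Sum.inl k)) from rfl,
          e'.injective.extend_apply]
        simp [plateau_eq_one hδ hpδ, hrp]
    · have hj' : ¬ ∃ k, e' k = j := fun ⟨k, hk⟩ => hj ⟨_, hk⟩
      rw [Function.extend_apply' _ _ _ hj, Function.extend_apply' _ _ _ hj', smul_zero]
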